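/- Let $k,n,j\ge 0$ be integers and let $\Omega\subset\mathbb{R}$ be a nonempty open set. Let $D\colon \mathscr{C}^k(\Omega)\to\mathscr{C}(\Omega)$ be a map (not assumed linear), where $\mathscr{C}^k(\Omega)$ is the algebra of $k$ times continuously differentiable real functions on $\Omega$ and $\mathscr{C}(\Omega)$ the space of continuous real functions on $\Omega$. Consider the identity $$\sum_{i=0}^{n}(-1)^{i}\sum_{\substack{I\subset\{1,\dots,n+1\}\\ \mathrm{card}(I)=i}}\Big(\prod_{m\in I}f_{m}\Big)\,D\Big(\prod_{m\in\{1,\dots,n+1\}\setminus I}f_{m}\Big)=0\qquad\text{for all } f_1,\dots,f_{n+1}\in\mathscr{C}^k(\Omega).\tag{1}$$ Suppose that $D$ satisfies (1) and that $D(p|_\Omega)=0$ for every real polynomial $p$ of degree at most $j$. Then there exist functions $c_{j+1},\dots,c_n\in\mathscr{C}(\Omega)$, with $c_i=0$ for every $i$ with $k<i\le n$, such that $$D(f)(x)=\sum_{i=j+1}^{n}c_i(x)\,f^{(i)}(x)\qquad\text{for all } f\in\mathscr{C}^k(\Omega),\ x\in\Omega \tag{2}$$ (the sum is empty if $n\le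 j$, and terms with $c_i=0$ are read as $0$). Moreover, if $k\le j$, then $D(f)=0$ for all $f\in\mathscr{C}^k(\Omega)$. Conversely, if $D\colon \mathscr{C}^k(\Omega)\to\mathscr{C}(\Omega)$ is given by (2) with some $c_{j+1},\dots,c_n\in\mathscr{C}(\Omega)$, then $D$ satisfies (1) and annihilates all polynomials of degree at most $j$. (Here, should some $c_i$ with $i>k$ not be assumed to be $0$, the value of a derivative of a function at a point where that function is not differentiable is read as $0$ in (2).) -/

import Mathlib

open scoped Polynomial

/-- The extension by zero to the whole real line of a real function on `Ω`. -/
noncomputable def zeroExt {Ω : Set ℝ} (f : Ω → ℝ) : ℝ → ℝ :=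
  Function.extend Subtype.val f 0

theorem zeroExt_apply {Ω : Set ℝ} (f : Ω → ℝ) (x : Ω) : zeroExt f x = f x :=
  Subtype.val_injective.extend_apply f 0 x

/-- The algebra `C^k(Ω)` of `k` times continuously differentiable functions `Ω → ℝ`
(for `Ω ⊆ ℝ` open), with pointwise operations. -/
noncomputable def CkFun (k : ℕ) (Ω : Set ℝ) : Subalgebra ℝ (Ω → ℝ) where
  carrier := {f | ContDiffOn ℝ k (zeroExt f) Ω}
  mul_mem' := by
    intro f g hf hg
    refine (ContDiffOn.mul hf hg).congr fun x hx => ?_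
    simp [fun u : Ω → ℝ => zeroExt_apply u ⟨x, hx⟩]
  add_mem' := by
    intro f g hf hg
    refine (ContDiffOn.add hf hg).congr fun x hx => ?_
    simp [fun u : Ω → ℝ => zeroExt_apply u ⟨x, hx⟩]
  algebraMap_mem' := by
    intro r
    refine (contDiffOn_const (c := r)).congr fun x hx => ?_
    simp [zeroExt_apply _ ⟨x, hx⟩]

/-- The `i`-th derivative `f^(i)(x)` at a point `x` of the open set `Ω`. For `f ∈ C^k(Ω)` and
`i ≤ k` it is the genuine derivative. -/
noncomputable def derivAt {Ω : Set ℝ} (i : ℕ) (f : Ω → ℝ) (x : Ω) : ℝ :=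
  iteratedDeriv i (zeroExt f) x

/-- The identity
`∑_{i=0}^{n} (-1)^i ∑_{card I = i} (∏_{m ∈ I} f_m) D(∏_{m ∉ I} f_m) = 0`
for all `n + 1` functions in `C^k(Ω)`, where `I` runs over the subsets of the index set.
The operator `D` is an arbitrary map; no linearity is assumed. -/
def SatisfiesIdentity {k : ℕ} {Ω : Set ℝ} (n : ℕ) (D : CkFun k Ω → C(Ω, ℝ)) : Prop :=
  ∀ (f : Fin (n + 1) → CkFun k Ω) (x : Ω),
    ∑ i ∈ Finset.range (n + 1), (-1 : ℝ) ^ i *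
      ∑ I ∈ Finset.powersetCard i (Finset.univ : Finset (Fin (n + 1))),
        (∏ m ∈ I, (f m : Ω → ℝ) x) * D (∏ m ∈ Iᶜ, f m) x = 0

/-- `D` annihilates (the restrictions to `Ω` of) all real polynomials of degree at most `j`. -/
def AnnihilatesPolynomials {k : ℕ} {Ω : Set ℝ} (j : ℕ) (D : CkFun k Ω → C(Ω, ℝ)) : Prop :=
  ∀ p : ℝ[X], p.natDegree ≤ j →
    ∀ f : CkFun k Ω, (∀ x : Ω, (f : Ω → ℝ) x = p.eval (x : ℝ)) → D f = 0

/-- `D(f)(x) = ∑_{i=j+1}^{n} c_i(x) f^(i)(x)` for all `f ∈ C^k(Ω)` and `x ∈ Ω`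
(an empty sum if `n ≤ j`). Only the `c i` with `j + 1 ≤ i ≤ n` matter. -/
def IsGivenBy {k : ℕ} {Ω : Set ℝ} (j n : ℕ) (c : ℕ → C(Ω, ℝ)) (D : CkFun k Ω → C(Ω, ℝ)) :
    Prop :=
  ∀ (f : CkFun k Ω) (x : Ω),
    D f x = ∑ i ∈ Finset.Icc (j + 1) n, c i x * derivAt i (f : Ω → ℝ) x

open Filter Topology Set

/-! Taking one factor `A` and all others equal to `B` turns (1) into a Leibniz rule of order `n`.
With a bump function for `B` it shows that `D f x` depends only on the germ of `f` at `x`; gluing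
two functions with equal `k`-jets and using continuity reduces this to the `k`-jet
(`IsLeibnizOp.eq_of_isLittleO`).

The difficulty is linearity. For `T g = exp (-g) * D (exp g)` the rule says that `n`-th differences
of `T` in a fixed direction do not depend on the base point, so differences of order `n + 1` vanish.
A Fréchet-type theorem makes `T` polynomial along lines wherever it is locally bounded in the
parameter, and unboundedness near `x` would contradict continuity of `T g` for a suitably glued `g`
(`IsLeibnizOp.expConj_add_smul`). Hence, for a polynomial `p`, `exp (-S) * D (exp S * (1 + W (p -
p(x)))) (x)`, read on jets through a truncated logarithm, is polynomial in `S`, `W` with continuous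
coefficients. For `ζ = p - p(x₀) > 0` it gives `D ζ / ζ` at `S = log ζ`, `W = 1 / ζ`. As `ζ → 0+`,
`D ζ` stays bounded; comparing growth leaves only the monomial `W` (`IsLeibnizOp.logJet_eq_mul`).
This is homogeneity, and polynomial dependence upgrades it to additivity. So `D f x` is linear in
the jet where `f x > 0`; `-D (-f)` covers negative values, simple zeros match the two sets of
coefficients, and continuity covers zeros.

Conversely, for `f ↦ f^(i)` the left side of (1) is the `i`-th derivative at `x` of `∏ (f_m -
f_m(x))`, which vanishes to order `n + 1 > i`. -/

/-! ### Gluing at a point and Taylor expansion -/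

/-- At `x₀` the cut-off function is dominated by `K = o(y - x₀)`, so cutting off commutes with
differentiation and induction on `k` applies. -/
theorem ContDiffOn.indicator_Ici {Ω : Set ℝ} (hΩ : IsOpen Ω) {x₀ : ℝ} (k : ℕ) {K : ℝ → ℝ}
    (hK : ContDiffOn ℝ k K Ω) (h0 : ∀ i ≤ k, iteratedDeriv i K x₀ = 0) :
    ContDiffOn ℝ k ((Ici x₀).indicator K) Ω := by
  have hlt : ∀ (G : ℝ → ℝ) (y : ℝ), y < x₀ → (Ici x₀).indicator G =ᶠ[𝓝 y] fun _ => 0 := by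
    intro G y hy
    filter_upwards [Iio_mem_nhds hy] with z hz
    simp [indicator, not_le.2 (mem_Iio.1 hz)]
  have hgt : ∀ (G : ℝ → ℝ) (y : ℝ), x₀ < y → (Ici x₀).indicator G =ᶠ[𝓝 y] G := by
    intro G y hy
    filter_upwards [Ioi_mem_nhds hy] with z hz
    simp [indicator, (mem_Ioi.1 hz).le]
  have hle : ∀ (G : ℝ → ℝ) (y : ℝ), ‖(Ici x₀).indicator G y‖ ≤ ‖G y‖ := fun G y =>
    norm_indicator_le_norm_self G y
  induction k generalizing K with
  | zero =>
    rw [CharP.cast_eq_zero, contDiffOn_zero] at hK ⊢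
    intro y hy
    rcases lt_trichotomy y x₀ with h | rfl | h
    · exact (continuousAt_const.congr (hlt K y h).symm).continuousWithinAt
    · have h00 : K y = 0 := by simpa using h0 0 le_rfl
      have hc : ContinuousAt K y := hK.continuousAt (hΩ.mem_nhds hy)
      refine ContinuousAt.continuousWithinAt ?_
      have : Tendsto (fun z => ‖K z‖) (𝓝 y) (𝓝 0) := by
        simpa [h00] using hc.norm.tendsto
      have h1 := squeeze_zero_norm (hle K) this
      unfold ContinuousAt
      simpa [h00] using h1
    · exact (((hK.continuousAt (hΩ.mem_nhds hy))).congr (hgt K y h).symm).continuousWithinAt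
  | succ k ih =>
    rw [Nat.cast_add, Nat.cast_one, contDiffOn_succ_iff_deriv_of_isOpen hΩ] at hK ⊢
    have hd : ∀ y ∈ Ω, HasDerivAt ((Ici x₀).indicator K) ((Ici x₀).indicator (deriv K) y) y := by
      intro y hy
      have hKy : HasDerivAt K (deriv K y) y :=
        ((hK.1 y hy).differentiableAt (hΩ.mem_nhds hy)).hasDerivAt
      rcases lt_trichotomy y x₀ with h | rfl | h
      · rw [(hlt (deriv K) y h).eq_of_nhds]
        exact (hasDerivAt_const y 0).congr_of_eventuallyEq (hlt K y h)
      · have h00 : K y = 0 := by simpa using h0 0 (by omega)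
        have h01 : deriv K y = 0 := by simpa using h0 1 (by omega)
        rw [h01, hasDerivAt_iff_isLittleO] at hKy
        have h1 : (Ici y).indicator (deriv K) y = 0 := by simp [h01]
        rw [h1, hasDerivAt_iff_isLittleO]
        simp only [h00, sub_zero, smul_zero, mem_Ici, le_refl, indicator_of_mem] at hKy ⊢
        exact (Asymptotics.IsBigO.of_bound 1 (Eventually.of_forall fun z => by
          simpa using hle K z)).trans_isLittleO hKy
      · rw [(hgt (deriv K) y h).eq_of_nhds]
        exact hKy.congr_of_eventuallyEq (hgt K y h)
    refine ⟨fun y hy => (hd y hy).differentiableAt.differentiableWithinAt, by simp, ?_⟩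
    refine (ih hK.2.2 fun i hi => ?_).congr fun y hy => (hd y hy).deriv
    rw [← iteratedDeriv_succ']
    exact h0 (i + 1) (by omega)

theorem ContDiffOn.taylor_isLittleO {Ω : Set ℝ} (hΩ : IsOpen Ω) {x₀ : ℝ} (hx₀ : x₀ ∈ Ω) {k : ℕ}
    {F : ℝ → ℝ} (hF : ContDiffOn ℝ k F Ω) :
    (fun x => F x - ∑ i ∈ Finset.range (k + 1),
      iteratedDeriv i F x₀ / i.factorial * (x - x₀) ^ i) =o[𝓝 x₀] fun x => (x - x₀) ^ k := by
  obtain ⟨r, hr, hb⟩ := Metric.isOpen_iff.1 hΩ x₀ hx₀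
  have h := _root_.taylor_isLittleO (convex_ball x₀ r) (Metric.mem_ball_self hr) (hF.mono hb)
  rw [Metric.isOpen_ball.nhdsWithin_eq (Metric.mem_ball_self hr)] at h
  refine h.congr_left fun x => ?_
  rw [taylor_within_apply]
  congr 1
  refine Finset.sum_congr rfl fun i _ => ?_
  rw [iteratedDerivWithin_of_isOpen Metric.isOpen_ball (Metric.mem_ball_self hr), smul_eq_mul]
  ring

/-- Once the lower derivatives vanish by induction, Taylor's formula leaves a multiple of `(x - x₀)
^ (k + 1)` that is little-o of that power. -/
theorem iteratedDeriv_eq_zero_of_isLittleO {Ω : Set ℝ} (hΩ : IsOpen Ω) {x₀ : ℝ} (hx₀ : x₀ ∈ Ω)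
    {k : ℕ} {K : ℝ → ℝ} (hK : ContDiffOn ℝ k K Ω) (ho : K =o[𝓝 x₀] fun x => (x - x₀) ^ k) :
    ∀ i ≤ k, iteratedDeriv i K x₀ = 0 := by
  induction k with
  | zero =>
    intro i hi
    obtain rfl : i = 0 := by omega
    simp only [pow_zero, Asymptotics.isLittleO_one_iff, CharP.cast_eq_zero, contDiffOn_zero]
      at ho hK
    simpa using tendsto_nhds_unique (hK.continuousAt (hΩ.mem_nhds hx₀)) ho
  | succ k ih =>
    have hpow : (fun x : ℝ => (x - x₀) ^ (k + 1)) =o[𝓝 x₀] fun x => (x - x₀) ^ k := by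
      have : Tendsto (fun x : ℝ => x - x₀) (𝓝 x₀) (𝓝 0) := by
        simpa using (continuous_sub_right x₀).tendsto x₀
      simpa [pow_succ] using
        (Asymptotics.isBigO_refl (fun x : ℝ => (x - x₀) ^ k) (𝓝 x₀)).mul_isLittleO
          ((Asymptotics.isLittleO_one_iff ℝ).2 this)
    have hlow := ih (hK.of_le (by exact_mod_cast Nat.le_succ k)) (ho.trans hpow)
    intro i hi
    rcases Nat.lt_or_ge i (k + 1) with h | h
    · exact hlow i (by omega)
    obtain rfl : i = k + 1 := by omega
    have ht := hK.taylor_isLittleO hΩ hx₀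
    have h2 := ho.sub ht
    have h3 : (fun x : ℝ => iteratedDeriv (k + 1) K x₀ / (k + 1).factorial * (x - x₀) ^ (k + 1))
        =o[𝓝 x₀] fun x => (x - x₀) ^ (k + 1) := by
      refine h2.congr_left fun x => ?_
      rw [Finset.sum_range_succ, Finset.sum_eq_zero]
      · ring
      · intro j hj
        rw [hlow j (by have := Finset.mem_range.1 hj; omega)]
        simp
    by_contra hne
    have hc : iteratedDeriv (k + 1) K x₀ / (k + 1).factorial ≠ 0 :=
      div_ne_zero hne (by positivity)
    rw [Asymptotics.isLittleO_const_mul_left_iff hc] at h3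
    have h4 : ∀ᶠ x in 𝓝[≠] x₀, (x - x₀) ^ (k + 1) = 0 :=
      ((Asymptotics.isLittleO_irrefl'
        (f' := fun x : ℝ => (x - x₀) ^ (k + 1)) (l := 𝓝[≠] x₀) · (h3.mono nhdsWithin_le_nhds))
        |> fun h => by
          by_contra hcon
          refine h ?_
          refine (Filter.not_eventually.1 hcon).mono fun x hx => by simpa using hx)
    obtain ⟨x, hx, hx'⟩ := (h4.and self_mem_nhdsWithin).exists
    exact hx' (by simpa [sub_eq_zero] using hx)

/-! ### Smooth functions with prescribed constants along a sequence -/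

/-- A series of bumps at points decreasing to `x₀`. The heights allowed by `η` are so small that all
derivatives up to order `k` converge uniformly, also at `x₀`. -/
theorem exists_smooth_eventuallyEq_const (k : ℕ) (x₀ : ℝ) {r : ℝ} (hr : 0 < r) :
    ∃ (x : ℕ → ℝ) (η : ℕ → ℝ), Tendsto x atTop (𝓝 x₀) ∧ (∀ l, x l ∈ Ioo x₀ (x₀ + r)) ∧
      (∀ l, 0 < η l) ∧ ∀ c : ℕ → ℝ, (∀ l, |c l| ≤ η l) →
        ∃ θ : ℝ → ℝ, ContDiff ℝ k θ ∧ ∀ l, θ =ᶠ[𝓝 (x l)] fun _ => c l := by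
  set a : ℕ → ℝ := fun l => r * (1 / 2) ^ (l + 1) with ha
  have apos : ∀ l, 0 < a l := fun l => by positivity
  have ahalf : ∀ m l, m < l → a l ≤ a m / 2 := by
    intro m l hml
    have : ((1 : ℝ) / 2) ^ (l + 1) ≤ (1 / 2) ^ (m + 1 + 1) :=
      pow_le_pow_of_le_one (by norm_num) (by norm_num) (by omega)
    have h2 := mul_le_mul_of_nonneg_left this hr.le
    simp only [ha]
    rw [pow_succ _ (m + 1)] at h2
    linarith
  have hpow : Tendsto a atTop (𝓝 0) := by
    have := ((tendsto_pow_atTop_nhds_zero_of_lt_one (r := (1 : ℝ) / 2) (by norm_num)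
      (by norm_num)).comp (tendsto_add_atTop_nat 1)).const_mul r
    simpa [ha] using this
  -- Two centres differ by at least half of the larger offset, so these radii make the bumps
  -- disjoint.
  let ρ : ∀ l, ContDiffBump (x₀ + a l) := fun l =>
    ⟨a l / 8, a l / 4, by have := apos l; positivity, by have := apos l; linarith⟩
  have hbd : ∀ l, ∀ i : ℕ, ∃ M, ∀ y, ‖iteratedFDeriv ℝ i (ρ l) y‖ ≤ M := fun l i =>
    ((ρ l).hasCompactSupport.iteratedFDeriv i).exists_bound_of_continuous
      ((ρ l).contDiff.continuous_iteratedFDeriv (n := i) le_rfl)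
  choose M hM using hbd
  have hM0 : ∀ l i, 0 ≤ M l i := fun l i => (norm_nonneg _).trans (hM l i 0)
  set B : ℕ → ℝ := fun l => 1 + ∑ i ∈ Finset.range (k + 1), M l i with hB
  have hB0 : ∀ l, 0 < B l := fun l => by
    have := Finset.sum_nonneg fun i (_ : i ∈ Finset.range (k + 1)) => hM0 l i
    simp only [hB]; linarith
  have hMB : ∀ l, ∀ i ≤ k, M l i ≤ B l := fun l i hi => by
    have := Finset.single_le_sum (fun j _ => hM0 l j)
      (Finset.mem_range.2 (Nat.lt_succ_of_le hi))
    simp only [hB]; linarith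
  refine ⟨fun l => x₀ + a l, fun l => (1 / 2) ^ l / B l, ?_, ?_, ?_, ?_⟩
  · simpa using hpow.const_add x₀
  · intro l
    have h1 : ((1 : ℝ) / 2) ^ (l + 1) < 1 := pow_lt_one₀ (by norm_num) (by norm_num) (by omega)
    have h2 : a l < r := by simpa [ha] using mul_lt_mul_of_pos_left h1 hr
    have := apos l
    constructor <;> linarith
  · intro l
    have := hB0 l
    positivity
  intro c hc
  refine ⟨fun y => ∑' l, c l * ρ l y, ?_, ?_⟩
  · refine contDiff_tsum (v := fun _ l => (1 / 2) ^ l)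
      (fun l => contDiff_const.mul (ρ l).contDiff) (fun _ _ => summable_geometric_two) ?_
    intro i l y hi
    have hi' : i ≤ k := by exact_mod_cast hi
    change ‖iteratedFDeriv ℝ i (c l • ⇑(ρ l)) y‖ ≤ _
    rw [iteratedFDeriv_const_smul_apply (ρ l).contDiff.contDiffAt, norm_smul, Real.norm_eq_abs]
    calc |c l| * ‖iteratedFDeriv ℝ i (ρ l) y‖ ≤ ((1 / 2) ^ l / B l) * B l :=
          mul_le_mul (hc l) ((hM l i y).trans (hMB l i hi')) (norm_nonneg _)
            ((abs_nonneg _).trans (hc l))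
      _ = (1 / 2) ^ l := div_mul_cancel₀ _ (hB0 l).ne'
  · intro l
    have hal : 0 < a l / 8 := by have := apos l; positivity
    filter_upwards [Metric.ball_mem_nhds (x₀ + a l) hal] with y hy
    rw [tsum_eq_single l]
    · rw [(ρ l).one_of_mem_closedBall (Metric.ball_subset_closedBall hy), mul_one]
    · intro m hm
      rw [(ρ m).zero_of_le_dist, mul_zero]
      change a m / 4 ≤ dist y (x₀ + a m)
      rw [Metric.mem_ball, Real.dist_eq, abs_lt] at hy
      rw [Real.dist_eq]
      have h1 := apos l
      have h2 := apos m
      rcases lt_or_gt_of_ne hm with h | h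
      · have := ahalf _ _ h
        exact le_trans (by linarith) (neg_le_abs _)
      · have := ahalf _ _ h
        exact le_trans (by linarith) (le_abs_self _)

/-! ### Fréchet's difference equation -/

/-- The Lagrange basis polynomials of the nodes `0, 1, …, n`. -/
noncomputable def natLagrange (n ν : ℕ) : ℝ[X] :=
  Lagrange.basis (Finset.range (n + 1)) (fun i : ℕ => (i : ℝ)) ν

theorem eval_eq_sum_natLagrange {n : ℕ} {P : ℝ[X]} (hP : P.natDegree ≤ n) (s : ℝ) :
    P.eval s = ∑ ν ∈ Finset.range (n + 1), P.eval (ν : ℝ) * (natLagrange n ν).eval s := by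
  have hinj : Set.InjOn (fun i : ℕ => (i : ℝ)) (Finset.range (n + 1)) :=
    fun a _ b _ h => Nat.cast_injective h
  have h := Lagrange.eq_interpolate_of_eval_eq (f := P) (fun i : ℕ => P.eval (i : ℝ)) hinj
    (by
      rw [Finset.card_range]
      exact lt_of_le_of_lt Polynomial.degree_le_natDegree (by exact_mod_cast Nat.lt_succ_of_le hP))
    (fun _ _ => rfl)
  conv_lhs => rw [h, Lagrange.interpolate_apply, Polynomial.eval_finsetSum]
  simp [natLagrange]

theorem eval_zero_natLagrange {n ν : ℕ} (h0 : 0 < ν) :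
    (natLagrange n ν).eval 0 = 0 := by
  have := Lagrange.eval_basis_of_ne (s := Finset.range (n + 1)) (v := fun i : ℕ => (i : ℝ))
    (i := ν) (j := 0) h0.ne' (by simp)
  simpa [natLagrange] using this

theorem eq_zero_of_forall_natCast_eval {n : ℕ} {P : ℝ[X]} (hP : P.natDegree ≤ n) (f : ℕ → ℕ)
    (hf : Function.Injective f) (h : ∀ i ≤ n, P.eval (f i : ℝ) = 0) : P = 0 := by
  refine Polynomial.eq_zero_of_natDegree_lt_card_of_eval_eq_zero P
    (f := fun i : Fin (n + 1) => (f i : ℝ)) ?_ (fun i => h i (by omega)) (by simp; omega)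
  intro a b hab
  exact Fin.ext (hf (Nat.cast_injective hab))

/-- Newton's formula: `φ (s + j r)` is the sum of `choose j k` times the `k`-th difference at `s`;
terms with `k > n` vanish and the binomials are polynomial in `j`. -/
theorem exists_polynomial_of_fwdDiff_iter_eq_zero {n : ℕ} {φ : ℝ → ℝ} {r : ℝ}
    (h : ∀ s, (fwdDiff r)^[n + 1] φ s = 0) (s : ℝ) :
    ∃ p : ℝ[X], p.natDegree ≤ n ∧ ∀ j : ℕ, p.eval (j : ℝ) = φ (s + j * r) := by
  have hz : ∀ k, n + 1 ≤ k → (fwdDiff r)^[k] φ s = 0 := by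
    intro k hk
    obtain ⟨m, rfl⟩ := Nat.exists_eq_add_of_le' hk
    rw [Function.iterate_add_apply, show (fwdDiff r)^[n + 1] φ = fun _ => 0 from funext h]
    clear hk
    induction m with
    | zero => rfl
    | succ m ih => rwa [Function.iterate_succ_apply, fwdDiff_const]
  refine ⟨∑ k ∈ Finset.range (n + 1),
    Polynomial.C ((fwdDiff r)^[k] φ s / k.factorial) * descPochhammer ℝ k, ?_, fun j => ?_⟩
  · refine Polynomial.natDegree_sum_le_of_forall_le _ _ fun k hk => ?_
    refine (Polynomial.natDegree_C_mul_le _ _).trans ?_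
    rw [descPochhammer_natDegree]
    have := Finset.mem_range.1 hk
    omega
  · have h1 := shift_eq_sum_fwdDiff_iter r φ j s
    rw [nsmul_eq_mul] at h1
    rw [h1, Polynomial.eval_finsetSum]
    have h2 : ∀ N, n + 1 ≤ N → ∑ k ∈ Finset.range (n + 1), (j.choose k) • (fwdDiff r)^[k] φ s
        = ∑ k ∈ Finset.range N, (j.choose k) • (fwdDiff r)^[k] φ s := by
      intro N hN
      refine Finset.sum_subset (Finset.range_mono hN) fun k _ hk => ?_
      rw [hz k (by simpa using hk), smul_zero]
    have h3 : ∀ N, j + 1 ≤ N → ∑ k ∈ Finset.range (j + 1), (j.choose k) • (fwdDiff r)^[k] φ s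
        = ∑ k ∈ Finset.range N, (j.choose k) • (fwdDiff r)^[k] φ s := by
      intro N hN
      refine Finset.sum_subset (Finset.range_mono hN) fun k _ hk => ?_
      rw [Nat.choose_eq_zero_of_lt (by simpa using hk), zero_smul]
    rw [h3 _ (le_max_right (n + 1) (j + 1)), ← h2 _ (le_max_left _ _)]
    refine Finset.sum_congr rfl fun k _ => ?_
    rw [Polynomial.eval_mul, Polynomial.eval_C, descPochhammer_eval_eq_descFactorial,
      Nat.descFactorial_eq_factorial_mul_choose, nsmul_eq_mul]
    push_cast
    field_simp

/-- On each arithmetic progression `ψ` is a polynomial of degree at most `n`, so `n + 1` zeros kill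
it there. This spreads the zeros to the integers and the rationals; boundedness gives small reals,
and scaling gives all. -/
theorem eq_zero_of_fwdDiff_iter_eq_zero {n : ℕ} {ψ : ℝ → ℝ}
    (h : ∀ r s, (fwdDiff r)^[n + 1] ψ s = 0) {δ C : ℝ} (hδ : 0 < δ)
    (hb : ∀ s, |s| < δ → |ψ s| ≤ C) (h0 : ∀ i : ℕ, i ≤ n → ψ i = 0) (s : ℝ) : ψ s = 0 := by
  have hnat : ∀ i : ℕ, ψ i = 0 := by
    intro i
    obtain ⟨p, hp, hpe⟩ := exists_polynomial_of_fwdDiff_iter_eq_zero (h 1) 0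
    have := eq_zero_of_forall_natCast_eval hp id Function.injective_id
      (fun i hi => by simp [hpe, h0 i hi])
    simpa [this] using (hpe i).symm
  have hint : ∀ z : ℤ, ψ z = 0 := by
    intro z
    obtain ⟨p, hp, hpe⟩ := exists_polynomial_of_fwdDiff_iter_eq_zero (h 1) (-(z.natAbs : ℝ))
    have := eq_zero_of_forall_natCast_eval hp (fun i => i + z.natAbs) (add_left_injective _)
      (fun i hi => by rw [hpe]; push_cast; simpa using hnat i)
    have h1 := hpe (z + z.natAbs).toNat
    have h2 : (((z + z.natAbs).toNat : ℕ) : ℝ) = z + z.natAbs := by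
      have : (((z + z.natAbs).toNat : ℕ) : ℤ) = z + z.natAbs := Int.toNat_of_nonneg (by omega)
      have h3 := congrArg (Int.cast : ℤ → ℝ) this
      rw [Int.cast_add, Int.cast_natCast, Int.cast_natCast] at h3
      exact h3
    rw [this, h2] at h1
    simpa using h1.symm
  have hrat : ∀ ρ : ℚ, ψ ρ = 0 := by
    intro ρ
    obtain ⟨p, hp, hpe⟩ := exists_polynomial_of_fwdDiff_iter_eq_zero (h ρ) 0
    have := eq_zero_of_forall_natCast_eval hp (fun i => i * ρ.den)
      (fun a b hab => Nat.eq_of_mul_eq_mul_right ρ.den_pos hab)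
      (fun i hi => by
        rw [hpe]
        have h1 : (ρ : ℝ) * ρ.den = ρ.num := by exact_mod_cast Rat.mul_den_eq_num ρ
        have h2 := hint (i * ρ.num)
        rw [show (0 : ℝ) + ((i * ρ.den : ℕ) : ℝ) * ρ = ((i * ρ.num : ℤ) : ℝ) by
          push_cast; rw [← h1]; ring]
        exact h2)
    simpa [this] using (hpe 1).symm
  have hC : 0 ≤ C := (abs_nonneg _).trans (hb 0 (by simpa using hδ))
  have hsmall : ∀ s, |s| < δ / 2 → ψ s = 0 := by
    intro s hs
    let E : ℝ → ℝ := fun z => ∑ i ∈ Finset.range n, |(natLagrange n (i + 1)).eval z|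
    have hE : Tendsto (fun M : ℕ => C * E (1 / ((M : ℝ) + 1))) atTop (𝓝 0) := by
      have hc : Continuous E := by
        refine continuous_finsetSum _ fun i _ => ?_
        exact (Polynomial.continuous _).abs
      have hE0 : E 0 = 0 := Finset.sum_eq_zero fun i _ => by
        rw [eval_zero_natLagrange (by omega), abs_zero]
      have := ((hc.tendsto 0).comp tendsto_one_div_add_atTop_nhds_zero_nat).const_mul C
      simpa [hE0] using this
    have hle : ∀ M : ℕ, |ψ s| ≤ C * E (1 / ((M : ℝ) + 1)) := by
      intro M
      have hD : (0 : ℝ) < n * (M + 1) + 1 := by positivity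
      -- With `ρ` this close to `s`, the points `ρ + (M + 1) i η`, `1 ≤ i ≤ n`, stay where `|ψ| ≤
      -- C`. In the variable `j / (M + 1)` the polynomial vanishes at `0`, is bounded by `C` at `1,
      -- …, n`, and takes the value `ψ s` at `1 / (M + 1)`, where the remaining basis polynomials
      -- are small.
      obtain ⟨ρ, hρ1, hρ2⟩ := exists_rat_btwn
        (show s < s + δ / (2 * (n * (M + 1) + 1)) by linarith [show 0 < δ / (2 * (n * ((M : ℝ) + 1) + 1)) by positivity])
      set η := s - ρ with hη
      have hηb : |η| < δ / (2 * (n * (M + 1) + 1)) := by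
        rw [abs_lt]; constructor <;> linarith [show 0 < δ / (2 * (n * ((M : ℝ) + 1) + 1)) by positivity]
      obtain ⟨p, hp, hpe⟩ := exists_polynomial_of_fwdDiff_iter_eq_zero (h η) ρ
      have h1 : ψ s = p.eval 1 := by
        have := hpe 1
        rw [show (ρ : ℝ) + (1 : ℕ) * η = s by simp [hη]] at this
        simpa using this.symm
      have hM : ((M : ℝ) + 1) ≠ 0 := by positivity
      have h2 : p.eval 1 =
          (p.comp (Polynomial.C ((M : ℝ) + 1) * Polynomial.X)).eval (1 / ((M : ℝ) + 1)) := by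
        simp [Polynomial.eval_comp, hM]
      have hdeg : (p.comp (Polynomial.C ((M : ℝ) + 1) * Polynomial.X)).natDegree ≤ n := by
        rw [Polynomial.natDegree_comp, Polynomial.natDegree_C_mul_X _ hM, mul_one]
        exact hp
      rw [h1, h2, eval_eq_sum_natLagrange hdeg, Finset.sum_range_succ']
      have hval : ∀ i : ℕ, (p.comp (Polynomial.C ((M : ℝ) + 1) * Polynomial.X)).eval (i : ℝ)
          = ψ (ρ + ((M + 1) * i : ℕ) * η) := by
        intro i
        rw [← hpe]
        simp [Polynomial.eval_comp]
      have hz : (p.comp (Polynomial.C ((M : ℝ) + 1) * Polynomial.X)).eval ((0 : ℕ) : ℝ) = 0 := by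
        rw [hval]
        simpa using hrat ρ
      rw [hz, zero_mul, add_zero, Finset.mul_sum]
      refine (Finset.abs_sum_le_sum_abs _ _).trans (Finset.sum_le_sum fun i hi => ?_)
      rw [abs_mul]
      refine mul_le_mul_of_nonneg_right ?_ (abs_nonneg _)
      rw [hval]
      refine hb _ ?_
      have hi' : ((i : ℝ) + 1) ≤ n := by exact_mod_cast Finset.mem_range.1 hi
      have h3 : (ρ : ℝ) + ((M + 1) * (i + 1) : ℕ) * η = s + ((M + 1) * (i + 1) - 1) * η := by
        push_cast [hη]; ring
      rw [h3]
      have h4 : (0 : ℝ) ≤ (M + 1) * (i + 1) - 1 := by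
        have : (0:ℝ) ≤ M * (i + 1) + i := by positivity
        linarith
      have h5 : ((M : ℝ) + 1) * (i + 1) - 1 ≤ n * (M + 1) + 1 := by
        have := mul_le_mul_of_nonneg_left hi' (show (0 : ℝ) ≤ M + 1 by positivity)
        linarith
      calc |s + ((M + 1) * (i + 1) - 1) * η| ≤ |s| + |((M + 1) * (i + 1) - 1) * η| := abs_add_le _ _
        _ = |s| + ((M + 1) * (i + 1) - 1) * |η| := by rw [abs_mul, abs_of_nonneg h4]
        _ ≤ |s| + (n * (M + 1) + 1) * (δ / (2 * (n * (M + 1) + 1))) := by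
            gcongr
        _ = |s| + δ / 2 := by field_simp
        _ < δ := by linarith
    have := ge_of_tendsto' hE hle
    exact abs_nonpos_iff.1 this
  -- For this `q` the multiples `i s / q`, `i ≤ n`, all have absolute value below `δ / 2`.
  obtain ⟨q, hq⟩ := exists_nat_gt ((n * |s| + 1) / (δ / 2))
  have hq0 : (0 : ℝ) < q := lt_of_le_of_lt (by positivity) hq
  obtain ⟨p, hp, hpe⟩ := exists_polynomial_of_fwdDiff_iter_eq_zero (h (s / q)) 0
  have := eq_zero_of_forall_natCast_eval hp id Function.injective_id
    (fun i hi => by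
      rw [id, hpe, zero_add]
      refine hsmall _ ?_
      have hi' : (i : ℝ) ≤ n := by exact_mod_cast hi
      rw [abs_mul, abs_div, Nat.abs_cast, Nat.abs_cast, ← mul_div_assoc, div_lt_iff₀ hq0]
      rw [div_lt_iff₀ (by positivity)] at hq
      have := mul_le_mul_of_nonneg_right hi' (abs_nonneg s)
      linarith)
  have h1 := hpe q
  rw [this, zero_add, mul_div_cancel₀ _ hq0.ne'] at h1
  simpa using h1.symm

/-- Subtracting the polynomial that interpolates `φ` at `0, …, n` reduces to the vanishing
statement. -/
theorem eq_sum_natLagrange_of_fwdDiff_iter_eq_zero {n : ℕ} {φ : ℝ → ℝ}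
    (h : ∀ r s, (fwdDiff r)^[n + 1] φ s = 0) {δ C : ℝ} (hδ : 0 < δ)
    (hb : ∀ s, |s| < δ → |φ s| ≤ C) (s : ℝ) :
    φ s = ∑ ν ∈ Finset.range (n + 1), φ ν * (natLagrange n ν).eval s := by
  obtain ⟨P, hP, hPe⟩ : ∃ P : ℝ[X], P.natDegree ≤ n ∧ ∀ i : ℕ, i ≤ n → P.eval (i : ℝ) = φ i := by
    obtain ⟨p, hp, hpe⟩ := exists_polynomial_of_fwdDiff_iter_eq_zero (h 1) 0
    exact ⟨p, hp, fun i _ => by simp [hpe]⟩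
  have hbP : ∃ C', ∀ s, |s| < δ → |P.eval s| ≤ C' := by
    obtain ⟨C', hC'⟩ := (isCompact_Icc (a := -δ) (b := δ)).exists_bound_of_continuousOn
      (Polynomial.continuous P).continuousOn
    exact ⟨C', fun s hs => hC' s ⟨(abs_lt.1 hs).1.le, (abs_lt.1 hs).2.le⟩⟩
  obtain ⟨C', hC'⟩ := hbP
  have key := eq_zero_of_fwdDiff_iter_eq_zero (n := n) (ψ := φ - fun s => P.eval s)
    (fun r s => by
      have hdeg : (P.comp (Polynomial.C r * Polynomial.X + Polynomial.C s)).natDegree < n + 1 := by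
        refine Nat.lt_succ_of_le (Polynomial.natDegree_comp_le.trans ?_)
        have := Nat.mul_le_mul hP (Polynomial.natDegree_linear_le (a := r) (b := s))
        simpa using this
      have h1 := h r s
      have h2 := congrFun (Polynomial.fwdDiff_iter_eq_zero_of_degree_lt hdeg) 0
      rw [fwdDiff_iter_eq_sum_shift] at h1 h2 ⊢
      simp only [Pi.sub_apply, smul_sub, Finset.sum_sub_distrib, h1, zero_sub, neg_eq_zero]
      refine Eq.trans (Finset.sum_congr rfl fun j _ => ?_) h2
      simp only [Polynomial.eval_comp, Polynomial.eval_add, Polynomial.eval_mul,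
        Polynomial.eval_C, Polynomial.eval_X, nsmul_eq_mul]
      congr 2
      ring)
    hδ (C := C + C') (fun s hs => (abs_sub _ _).trans (add_le_add (hb s hs) (hC' s hs)))
    (fun i hi => by simp [hPe i hi]) s
  rw [Pi.sub_apply, sub_eq_zero] at key
  rw [key, eval_eq_sum_natLagrange hP]
  refine Finset.sum_congr rfl fun ν hν => ?_
  rw [hPe ν (by have := Finset.mem_range.1 hν; omega)]

/-! ### Locality, dependence on jets, and polynomiality along lines -/

theorem eq_of_frequently_eq {Ω : Set ℝ} (hΩ : IsOpen Ω) {φ ψ : Ω → ℝ} (hφ : Continuous φ)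
    (hψ : Continuous ψ) {x : Ω} (h : ∃ᶠ y in 𝓝 (x : ℝ), ∀ hy : y ∈ Ω, φ ⟨y, hy⟩ = ψ ⟨y, hy⟩) :
    φ x = ψ x := by
  rw [← hΩ.isOpenEmbedding_subtypeVal.map_nhds_eq, Filter.frequently_map] at h
  have hcl : IsClosed {y | φ y = ψ y} := isClosed_eq hφ hψ
  exact hcl.closure_subset (mem_closure_iff_frequently.2 (h.mono fun y hy => hy y.2))

/-- An operator `L` on functions of class `C^k` on `Ω` that annihilates constants and satisfies the
Leibniz type identity of order `n`, with one factor `A` and `n` equal factors `B`. -/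
structure IsLeibnizOp (k n : ℕ) {Ω : Set ℝ} (L : (ℝ → ℝ) → C(Ω, ℝ)) : Prop where
  map_const : ∀ c : ℝ, L (fun _ => c) = 0
  leibniz : ∀ A B : ℝ → ℝ, ContDiffOn ℝ k A Ω → ContDiffOn ℝ k B Ω → ∀ x : Ω,
    ∑ a ∈ Finset.range (n + 1), (n.choose a : ℝ) *
      ((-B x) ^ a * (L (A * B ^ (n - a)) x - A x * L (B ^ (n - a)) x)) = 0

/-- The conjugate of `L` by the exponential function. -/
noncomputable def expConj {Ω : Set ℝ} (L : (ℝ → ℝ) → C(Ω, ℝ)) (g : ℝ → ℝ) (x : Ω) : ℝ :=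
  Real.exp (-g x) * L (fun y => Real.exp (g y)) x

theorem apply_exp_eq {Ω : Set ℝ} (L : (ℝ → ℝ) → C(Ω, ℝ)) (g : ℝ → ℝ) (x : Ω) :
    L (fun y => Real.exp (g y)) x = Real.exp (g x) * expConj L g x := by
  rw [expConj, ← mul_assoc, ← Real.exp_add, add_neg_cancel, Real.exp_zero, one_mul]

theorem continuous_expConj {Ω : Set ℝ} (L : (ℝ → ℝ) → C(Ω, ℝ)) {g : ℝ → ℝ}
    (hg : ContinuousOn g Ω) : Continuous (expConj L g) := by
  have : Continuous fun x : Ω => g x := continuousOn_iff_continuous_domRestrict.1 hg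
  exact (Real.continuous_exp.comp this.neg).mul (L _).continuous

namespace IsLeibnizOp

variable {k n : ℕ} {Ω : Set ℝ} {L : (ℝ → ℝ) → C(Ω, ℝ)}

/-- Let `B` be a bump equal to `1` at `x` and supported where `F = G`. Terms with `a < n` contain a
factor `B` inside `L` and agree; the term `a = n` isolates `L F x` and `L G x`. -/
theorem eq_of_eventuallyEq (hL : IsLeibnizOp k n L) {F G : ℝ → ℝ} (hF : ContDiffOn ℝ k F Ω)
    (hG : ContDiffOn ℝ k G Ω) {x : Ω} (h : F =ᶠ[𝓝 (x : ℝ)] G) : L F x = L G x := by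
  obtain ⟨ε, hε, hb⟩ := Metric.eventually_nhds_iff.1 h
  let ρ : ContDiffBump (x : ℝ) := ⟨ε / 2, ε, by positivity, by linarith⟩
  have hρ1 : ρ x = 1 := ρ.one_of_mem_closedBall (Metric.mem_closedBall_self (by positivity))
  have hFG : F * ⇑ρ = G * ⇑ρ := by
    ext y
    simp only [Pi.mul_apply]
    by_cases hy : dist y x < ε
    · rw [hb hy]
    · rw [ρ.zero_of_le_dist (not_lt.1 hy), mul_zero, mul_zero]
  have hpow : ∀ m, m ≠ 0 → F * (⇑ρ) ^ m = G * (⇑ρ) ^ m := by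
    intro m hm
    obtain ⟨m, rfl⟩ := Nat.exists_eq_succ_of_ne_zero hm
    rw [pow_succ', ← mul_assoc, ← mul_assoc, hFG]
  have hρ : ContDiffOn ℝ k (⇑ρ) Ω := ρ.contDiff.contDiffOn
  have h1 := hL.leibniz F ρ hF hρ x
  have h2 := hL.leibniz G ρ hG hρ x
  rw [Finset.sum_range_succ] at h1 h2
  have h3 : ∀ a ∈ Finset.range n, (n.choose a : ℝ) *
      ((-ρ x) ^ a * (L (F * (⇑ρ) ^ (n - a)) x - F x * L ((⇑ρ) ^ (n - a)) x)) =
      (n.choose a : ℝ) *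
      ((-ρ x) ^ a * (L (G * (⇑ρ) ^ (n - a)) x - G x * L ((⇑ρ) ^ (n - a)) x)) := by
    intro a ha
    rw [hpow _ (by have := Finset.mem_range.1 ha; omega), h.eq_of_nhds]
  rw [Finset.sum_congr rfl h3] at h1
  have h4 := (add_left_cancel (h1.trans h2.symm))
  have hu : ((-1 : ℝ)) ^ n ≠ 0 := pow_ne_zero _ (by norm_num)
  simp only [Nat.choose_self, Nat.cast_one, one_mul, hρ1, Nat.sub_self, pow_zero, mul_one,
    mul_right_inj' hu, h.eq_of_nhds] at h4
  linarith

/-- The function `H`, equal to `F` left of `x` and to `G` right of it, is of class `C^k`. Locality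
identifies `L H` on each side, and continuity carries both equalities to `x`. -/
theorem eq_of_isLittleO (hΩ : IsOpen Ω) (hL : IsLeibnizOp k n L) {F G : ℝ → ℝ}
    (hF : ContDiffOn ℝ k F Ω) (hG : ContDiffOn ℝ k G Ω) {x : Ω}
    (h : (fun y => G y - F y) =o[𝓝 (x : ℝ)] fun y => (y - x) ^ k) : L F x = L G x := by
  have hK : ContDiffOn ℝ k (fun y => G y - F y) Ω := hG.sub hF
  have hI := hK.indicator_Ici hΩ k (iteratedDeriv_eq_zero_of_isLittleO hΩ x.2 hK h)
  have hH : ContDiffOn ℝ k (fun y => F y + (Ici (x : ℝ)).indicator (fun y => G y - F y) y) Ω :=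
    hF.add hI
  set H := fun y => F y + (Ici (x : ℝ)).indicator (fun y => G y - F y) y with hHdef
  have h1 : L H x = L F x := by
    refine eq_of_frequently_eq hΩ (L H).continuous (L F).continuous ?_
    have : ∃ᶠ y in 𝓝 (x : ℝ), y < (x : ℝ) := frequently_lt_nhds (x.1)
    refine this.mono fun y hy hyΩ => hL.eq_of_eventuallyEq hH hF ?_
    filter_upwards [Iio_mem_nhds hy] with z hz
    simp [hHdef, indicator, not_le.2 (mem_Iio.1 hz)]
  have h2 : L H x = L G x := by
    refine eq_of_frequently_eq hΩ (L H).continuous (L G).continuous ?_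
    have : ∃ᶠ y in 𝓝 (x : ℝ), (x : ℝ) < y := frequently_gt_nhds (x.1)
    refine this.mono fun y hy hyΩ => hL.eq_of_eventuallyEq hH hG ?_
    filter_upwards [Ioi_mem_nhds hy] with z hz
    simp [hHdef, indicator, (mem_Ioi.1 hz).le]
  exact h1.symm.trans h2

/-- Transfers results on positive functions to negative ones. The rule for `-A` is corrected by `A
x` times the rule for the constant `-1`. -/
theorem neg_comp_neg (hL : IsLeibnizOp k n L) : IsLeibnizOp k n fun F => -L (-F) where
  map_const c := by
    have : (-fun _ => c : ℝ → ℝ) = fun _ => -c := rfl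
    rw [this, hL.map_const, neg_zero]
  leibniz A B hA hB x := by
    have h1 := hL.leibniz (-A) B hA.neg hB x
    have h2 := hL.leibniz (fun _ => -1) B contDiffOn_const hB x
    have h3 : (0 : ℝ) = -0 + A x * 0 := by simp
    rw [h3]
    nth_rw 1 [← h1]
    rw [← h2, Finset.mul_sum, ← Finset.sum_neg_distrib, ← Finset.sum_add_distrib]
    refine Finset.sum_congr rfl fun a _ => ?_
    have e1 : -A * B ^ (n - a) = -(A * B ^ (n - a)) := neg_mul _ _
    have e2 : (fun _ => (-1 : ℝ)) * B ^ (n - a) = -(B ^ (n - a)) := by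
      ext y; simp
    rw [e1, e2]
    simp only [ContinuousMap.coe_neg, Pi.neg_apply]
    ring

theorem expConj_eq_of_eventuallyEq (hL : IsLeibnizOp k n L) {F G : ℝ → ℝ}
    (hF : ContDiffOn ℝ k F Ω) (hG : ContDiffOn ℝ k G Ω) {x : Ω} (h : F =ᶠ[𝓝 (x : ℝ)] G) :
    expConj L F x = expConj L G x := by
  rw [expConj, expConj, h.eq_of_nhds, hL.eq_of_eventuallyEq hF.exp hG.exp]
  filter_upwards [h] with y hy
  rw [hy]

theorem sum_expConj (hL : IsLeibnizOp k n L) {g w : ℝ → ℝ} (hg : ContDiffOn ℝ k g Ω)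
    (hw : ContDiffOn ℝ k w Ω) (x : Ω) :
    ∑ a ∈ Finset.range (n + 1), (n.choose a : ℝ) * ((-1) ^ a *
      (expConj L (g + ((n - a : ℕ) : ℝ) • w) x - expConj L (((n - a : ℕ) : ℝ) • w) x)) = 0 := by
  have h := hL.leibniz (fun y => Real.exp (g y)) (fun y => Real.exp (w y)) hg.exp hw.exp x
  have hne : Real.exp (g x + n * w x) ≠ 0 := (Real.exp_pos _).ne'
  refine (mul_eq_zero.1 (Eq.trans ?_ h)).resolve_left hne
  rw [Finset.mul_sum]
  refine Finset.sum_congr rfl fun a ha => ?_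
  have hfun : ∀ m : ℕ, (fun y => Real.exp (w y)) ^ m = fun y => Real.exp (((m : ℝ) • w) y) := by
    intro m
    ext y
    simp [← Real.exp_nat_mul]
  have hfun2 : ∀ m : ℕ, ((fun y => Real.exp (g y)) * fun y => Real.exp (((m : ℝ) • w) y)) =
      fun y => Real.exp ((g + (m : ℝ) • w) y) := by
    intro m
    ext y
    simp [← Real.exp_add]
  rw [hfun, hfun2, apply_exp_eq, apply_exp_eq, neg_pow (Real.exp _), ← Real.exp_nat_mul (w x) a]
  have hna : (n : ℝ) = a + (n - a : ℕ) := by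
    have : a ≤ n := by have := Finset.mem_range.1 ha; omega
    push_cast [this]; ring
  conv_lhs => rw [hna]
  simp only [Pi.add_apply, Pi.smul_apply, smul_eq_mul, add_mul, Real.exp_add]
  ring

/-- The rule expresses the `n`-th difference at `g + s • h` in direction `r • h` by terms free of
`s`, so one more difference vanishes. -/
theorem fwdDiff_iter_expConj (hL : IsLeibnizOp k n L) {g h : ℝ → ℝ} (hg : ContDiffOn ℝ k g Ω)
    (hh : ContDiffOn ℝ k h Ω) (x : Ω) (r s : ℝ) :
    (fwdDiff r)^[n + 1] (fun c => expConj L (g + c • h) x) s = 0 := by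
  have key : ∀ s, (fwdDiff r)^[n] (fun c => expConj L (g + c • h) x) s =
      ∑ a ∈ Finset.range (n + 1), (n.choose a : ℝ) * ((-1) ^ a *
        expConj L (((n - a : ℕ) : ℝ) • (r • h)) x) := by
    intro s
    have h1 := hL.sum_expConj (hg.add (hh.const_smul s)) (hh.const_smul r) x
    simp only [mul_sub, Finset.sum_sub_distrib, sub_eq_zero] at h1
    refine Eq.trans ?_ h1
    rw [fwdDiff_iter_eq_sum_shift, ← Finset.sum_range_reflect]
    refine Finset.sum_congr rfl fun a ha => ?_
    have ha' : a ≤ n := by have := Finset.mem_range.1 ha; omega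
    rw [show n + 1 - 1 - a = n - a by omega, show n - (n - a) = a by omega, Nat.choose_symm ha']
    have hfun : g + (s + ((n - a : ℕ) : ℝ) • r) • h = (g + fun y => s • h y) + ((n - a : ℕ) : ℝ) • fun y => r • h y := by
      ext y
      simp
      ring
    have hfun2 : (g + fun y => s • h y) + ((n - a : ℕ) : ℝ) • (fun y => r • h y) =
      (fun y => g y + s • h y) + ((n - a : ℕ) : ℝ) • fun y => r • h y := rfl
    rw [nsmul_eq_mul, ← smul_eq_mul (a := ((n - a : ℕ) : ℝ)), hfun, zsmul_eq_mul]
    push_cast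
    rw [mul_comm ((-1 : ℝ) ^ a), mul_assoc]
    rfl
  rw [Function.iterate_succ_apply', fwdDiff, key, key, sub_self]

/-- If the formula failed at all points near `x`, then at each point just right of `x` the map `c ↦
expConj L (g + c • h)` would be unbounded near `c = 0`. Gluing bad constants along a sequence
tending to `x` contradicts continuity. -/
theorem expConj_add_smul (hΩ : IsOpen Ω) (hL : IsLeibnizOp k n L) {g h : ℝ → ℝ}
    (hg : ContDiffOn ℝ k g Ω) (hh : ContDiffOn ℝ k h Ω) (x : Ω) (s : ℝ) :
    expConj L (g + s • h) x = ∑ ν ∈ Finset.range (n + 1),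
      expConj L (g + (ν : ℝ) • h) x * (natLagrange n ν).eval s := by
  have hC : ∀ c : ℝ, Continuous (expConj L (g + c • h)) := fun c =>
    continuous_expConj L (hg.add (hh.const_smul c)).continuousOn
  refine eq_of_frequently_eq hΩ (hC s)
    (ψ := fun x => ∑ ν ∈ Finset.range (n + 1),
      expConj L (g + (ν : ℝ) • h) x * (natLagrange n ν).eval s)
    (continuous_finsetSum _ fun ν _ => (hC ν).mul continuous_const) ?_
  by_contra hcon
  rw [Filter.not_frequently] at hcon
  obtain ⟨r, hr, hb⟩ := Metric.eventually_nhds_iff.1 hcon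
  have hbad : ∀ y ∈ Ioo (x : ℝ) (x + r), ∃ hy : y ∈ Ω, ∀ δ C : ℝ, 0 < δ →
      ∃ c, |c| < δ ∧ C < |expConj L (g + c • h) ⟨y, hy⟩| := by
    intro y hy
    have h1 := hb (y := y) (by rw [Real.dist_eq, abs_lt]; constructor <;> linarith [hy.1, hy.2])
    push Not at h1
    obtain ⟨hyΩ, hne⟩ := h1
    refine ⟨hyΩ, fun δ C hδ => ?_⟩
    by_contra hcon2
    push Not at hcon2
    exact hne (eq_sum_natLagrange_of_fwdDiff_iter_eq_zero
      (fun r s => hL.fwdDiff_iter_expConj hg hh ⟨y, hyΩ⟩ r s) hδ hcon2 s)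
  obtain ⟨z, η, hz, hzr, hη, hθ⟩ := exists_smooth_eventuallyEq_const k (x : ℝ) hr
  choose hzΩ hzc using fun l => hbad (z l) (hzr l)
  choose c hc1 hc2 using fun l : ℕ => hzc l (η l) l (hη l)
  -- Near `z l` the single function `g + θ * h` is `g + c l • h`, so by locality its `expConj`
  -- exceeds `l` in absolute value at `z l`.
  obtain ⟨θ, hθs, hθc⟩ := hθ c fun l => (hc1 l).le
  have hf : ContDiffOn ℝ k (g + θ * h) Ω := hg.add (hθs.contDiffOn.mul hh)
  have hlim : Tendsto (fun l => expConj L (g + θ * h) ⟨z l, hzΩ l⟩) atTop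
      (𝓝 (expConj L (g + θ * h) x)) :=
    ((continuous_expConj L hf.continuousOn).tendsto x).comp (tendsto_subtype_rng.2 hz)
  have heq : ∀ l, expConj L (g + θ * h) ⟨z l, hzΩ l⟩ = expConj L (g + c l • h) ⟨z l, hzΩ l⟩ := by
    intro l
    refine hL.expConj_eq_of_eventuallyEq hf (hg.add (hh.const_smul (c l))) ?_
    filter_upwards [hθc l] with y hy
    simp [hy]
  refine not_tendsto_nhds_of_tendsto_atTop ?_ _ hlim.abs
  refine tendsto_atTop_mono (fun l => ?_) tendsto_natCast_atTop_atTop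
  rw [heq]
  exact (hc2 l).le

end IsLeibnizOp

/-! ### Polynomial dependence on parameters -/

/-- Evaluation at `x`, `S`, `W` of a polynomial in two variables with coefficients in `C(Ω, ℝ)`. -/
noncomputable def paramEval {Ω : Set ℝ} (x : Ω) (S W : ℝ) :
    MvPolynomial (Fin 2) C(Ω, ℝ) →+* ℝ :=
  MvPolynomial.eval₂Hom ((Pi.evalRingHom (fun _ : Ω => ℝ) x).comp ContinuousMap.coeFnRingHom)
    ![S, W]

theorem paramEval_eq_sum {Ω : Set ℝ} (x : Ω) (S W : ℝ) (P : MvPolynomial (Fin 2) C(Ω, ℝ)) :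
    paramEval x S W P = ∑ m ∈ P.support, P.coeff m x * (S ^ m 0 * W ^ m 1) := by
  simp [paramEval, MvPolynomial.eval₂_eq']

/-- A function of `x`, `S`, `W` that is polynomial in `S`, `W` with continuous coefficients. -/
def IsParamPoly {Ω : Set ℝ} (Φ : Ω → ℝ → ℝ → ℝ) : Prop :=
  ∃ P : MvPolynomial (Fin 2) C(Ω, ℝ), ∀ x S W, Φ x S W = paramEval x S W P

namespace IsParamPoly

variable {Ω : Set ℝ} {Φ Ψ : Ω → ℝ → ℝ → ℝ}

theorem of_continuous {f : Ω → ℝ} (hf : Continuous f) : IsParamPoly fun x _ _ => f x :=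
  ⟨MvPolynomial.C ⟨f, hf⟩, fun x S W => by simp [paramEval]⟩

theorem fst : IsParamPoly fun (_ : Ω) S _ => S :=
  ⟨MvPolynomial.X 0, fun x S W => by simp [paramEval]⟩

theorem snd : IsParamPoly fun (_ : Ω) _ W => W :=
  ⟨MvPolynomial.X 1, fun x S W => by simp [paramEval]⟩

theorem mul (hΦ : IsParamPoly Φ) (hΨ : IsParamPoly Ψ) :
    IsParamPoly fun x S W => Φ x S W * Ψ x S W := by
  obtain ⟨P, hP⟩ := hΦ
  obtain ⟨Q, hQ⟩ := hΨ
  exact ⟨P * Q, fun x S W => by simp only [map_mul, hP, hQ]⟩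

theorem pow (hΦ : IsParamPoly Φ) (m : ℕ) : IsParamPoly fun x S W => Φ x S W ^ m := by
  obtain ⟨P, hP⟩ := hΦ
  exact ⟨P ^ m, fun x S W => by simp only [map_pow, hP]⟩

theorem sum {ι : Type*} (s : Finset ι) {Φ : ι → Ω → ℝ → ℝ → ℝ} (h : ∀ i ∈ s, IsParamPoly (Φ i)) :
    IsParamPoly fun x S W => ∑ i ∈ s, Φ i x S W := by
  choose! P hP using h
  exact ⟨∑ i ∈ s, P i, fun x S W => by
    rw [map_sum]; exact Finset.sum_congr rfl fun i hi => hP i hi x S W⟩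

theorem eval (hΦ : IsParamPoly Φ) (p : ℝ[X]) : IsParamPoly fun x S W => p.eval (Φ x S W) := by
  simp only [Polynomial.eval_eq_sum_range]
  exact sum _ fun i _ => (of_continuous continuous_const).mul (hΦ.pow i)

theorem continuous (hΦ : IsParamPoly Φ) (S W : ℝ) : Continuous fun x => Φ x S W := by
  obtain ⟨P, hP⟩ := hΦ
  simp only [hP, paramEval_eq_sum]
  exact continuous_finsetSum _ fun m _ => (P.coeff m).continuous.mul continuous_const

theorem exists_polynomial (hΦ : IsParamPoly Φ) (x : Ω) (S : ℝ) :
    ∃ p : ℝ[X], ∀ W, Φ x S W = p.eval W := by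
  obtain ⟨P, hP⟩ := hΦ
  refine ⟨∑ m ∈ P.support, Polynomial.C (P.coeff m x * S ^ m 0) * Polynomial.X ^ m 1, fun W => ?_⟩
  rw [hP, paramEval_eq_sum, Polynomial.eval_finsetSum]
  refine Finset.sum_congr rfl fun m _ => ?_
  simp [mul_assoc]

end IsParamPoly

/-- Interpolation in one direction at a time; each node shifts the base point, hence the induction
over all `g`. -/
theorem IsLeibnizOp.isParamPoly_expConj_sum {k n : ℕ} {Ω : Set ℝ} {L : (ℝ → ℝ) → C(Ω, ℝ)}
    (hΩ : IsOpen Ω) (hL : IsLeibnizOp k n L) {ι : Type*} (s : Finset ι) {G : ι → ℝ → ℝ}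
    (hG : ∀ i ∈ s, ContDiffOn ℝ k (G i) Ω) {σ : ι → Ω → ℝ → ℝ → ℝ}
    (hσ : ∀ i ∈ s, IsParamPoly (σ i)) {g : ℝ → ℝ} (hg : ContDiffOn ℝ k g Ω) :
    IsParamPoly fun x S W => expConj L (g + ∑ i ∈ s, σ i x S W • G i) x := by
  classical
  induction s using Finset.induction_on generalizing g with
  | empty => simpa using IsParamPoly.of_continuous (continuous_expConj L hg.continuousOn)
  | insert a s ha ih =>
    have hGa := hG a (Finset.mem_insert_self a s)
    have hGs : ∀ i ∈ s, ContDiffOn ℝ k (G i) Ω := fun i hi => hG i (Finset.mem_insert_of_mem hi)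
    have hsum : ∀ x S W, ContDiffOn ℝ k (∑ i ∈ s, σ i x S W • G i) Ω := by
      intro x S W
      have : ContDiffOn ℝ k (fun y => ∑ i ∈ s, (σ i x S W • G i) y) Ω :=
        ContDiffOn.sum fun i hi => (hGs i hi).const_smul (σ i x S W)
      convert this using 1
      ext y
      simp
    have h1 : ∀ x S W, expConj L (g + ∑ i ∈ insert a s, σ i x S W • G i) x =
        ∑ ν ∈ Finset.range (n + 1),
          expConj L ((g + (ν : ℝ) • G a) + ∑ i ∈ s, σ i x S W • G i) x *
            (natLagrange n ν).eval (σ a x S W) := by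
      intro x S W
      rw [Finset.sum_insert ha, add_comm (σ a x S W • G a), ← add_assoc,
        hL.expConj_add_smul hΩ (g := g + ∑ i ∈ s, σ i x S W • G i) (hg.add (hsum x S W)) hGa]
      refine Finset.sum_congr rfl fun ν _ => ?_
      rw [add_right_comm]
    simp only [h1]
    refine IsParamPoly.sum _ fun ν _ => IsParamPoly.mul ?_ ((hσ a (Finset.mem_insert_self a s)).eval _)
    exact ih hGs (fun i hi => hσ i (Finset.mem_insert_of_mem hi)) (hg.add (hGa.const_smul (ν : ℝ)))

/-! ### Logarithmic jets of polynomials -/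

/-- The coefficients of `S + log (1 + W u)` as a power series in `u`. -/
noncomputable def logCoeff (S W : ℝ) : ℕ → ℝ
  | 0 => S
  | i + 1 => (-1) ^ i / (i + 1) * W ^ (i + 1)

/-- The exponent `S + log (1 + W (p - p(x)))`, truncated at order `k`. -/
noncomputable def logTaylor (k : ℕ) (p : ℝ[X]) (x S W y : ℝ) : ℝ :=
  ∑ i ∈ Finset.range (k + 1), logCoeff S W i * (p.eval y - p.eval x) ^ i

theorem contDiff_logTaylor (k : ℕ) (p : ℝ[X]) (x S W : ℝ) {m : WithTop ℕ∞} :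
    ContDiff ℝ m (logTaylor k p x S W) :=
  ContDiff.sum fun _ _ => contDiff_const.mul
    (((Polynomial.contDiff_aeval p m).sub contDiff_const).pow _)

theorem logTaylor_self (k : ℕ) (p : ℝ[X]) (x S W : ℝ) : logTaylor k p x S W x = S := by
  simp [logTaylor, Finset.sum_range_succ', logCoeff]

theorem abs_logTaylor_sub_le (k : ℕ) (p : ℝ[X]) (x S W y : ℝ)
    (h : |W * (p.eval y - p.eval x)| < 1) :
    |logTaylor k p x S W y - (S + Real.log (1 + W * (p.eval y - p.eval x)))| ≤
      |W * (p.eval y - p.eval x)| ^ (k + 1) / (1 - |W * (p.eval y - p.eval x)|) := by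
  set u := p.eval y - p.eval x
  have h1 := Real.abs_log_sub_add_sum_range_le (x := -(W * u)) (by rwa [abs_neg]) k
  rw [abs_neg, sub_neg_eq_add] at h1
  rw [← abs_neg]
  convert h1 using 2
  rw [logTaylor, Finset.sum_range_succ', ← sub_eq_zero]
  have : ∑ i ∈ Finset.range k, (-(W * u)) ^ (i + 1) / ((i : ℝ) + 1) =
      -∑ i ∈ Finset.range k, logCoeff S W (i + 1) * u ^ (i + 1) := by
    rw [← Finset.sum_neg_distrib]
    refine Finset.sum_congr rfl fun i _ => ?_
    rw [logCoeff, neg_pow, mul_pow]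
    ring
  rw [this, show p.eval y - p.eval x = u from rfl]
  simp only [logCoeff, pow_zero]
  ring

/-- For these `S`, `W` the full exponent is `log p`. Truncation costs `O((y - x) ^ (k + 1))`, and
`exp` is Lipschitz near `log p(x)`. -/
theorem exp_logTaylor_sub_isLittleO (k : ℕ) (p : ℝ[X]) {x : ℝ} (hx : 0 < p.eval x) :
    (fun y => Real.exp (logTaylor k p x (Real.log (p.eval x)) (p.eval x)⁻¹ y) - p.eval y)
      =o[𝓝 x] fun y => (y - x) ^ k := by
  set c := p.eval x with hc
  have hu : (fun y => c⁻¹ * (p.eval y - c)) =O[𝓝 x] fun y => y - x :=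
    (p.differentiableAt.isBigO_sub).const_mul_left _
  have hu0 : Tendsto (fun y => c⁻¹ * (p.eval y - c)) (𝓝 x) (𝓝 0) := by
    have : Continuous fun y => c⁻¹ * (p.eval y - c) := by fun_prop
    simpa [hc] using this.tendsto x
  have hlt : ∀ᶠ y in 𝓝 x, |c⁻¹ * (p.eval y - c)| < 1 / 2 := by
    have := hu0.abs
    rw [abs_zero] at this
    exact this.eventually_lt_const (by norm_num)
  have hlog : (fun y => logTaylor k p x (Real.log c) c⁻¹ y - Real.log (p.eval y))
      =O[𝓝 x] fun y => (y - x) ^ (k + 1) := by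
    refine Asymptotics.IsBigO.trans (Asymptotics.IsBigO.of_bound 2 ?_) (hu.pow (k + 1))
    filter_upwards [hlt] with y hy
    have h1 := abs_logTaylor_sub_le k p x (Real.log c) c⁻¹ y (by linarith)
    have hpos : 0 < 1 + c⁻¹ * (p.eval y - c) := by
      have := neg_abs_le (c⁻¹ * (p.eval y - c))
      linarith
    have h2 : Real.log (p.eval y) = Real.log c + Real.log (1 + c⁻¹ * (p.eval y - c)) := by
      rw [← Real.log_mul hx.ne' hpos.ne']
      congr 1
      field_simp
      ring
    rw [h2, Real.norm_eq_abs, norm_pow, Real.norm_eq_abs]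
    refine h1.trans ?_
    rw [div_le_iff₀ (by linarith)]
    have := pow_nonneg (abs_nonneg (c⁻¹ * (p.eval y - c))) (k + 1)
    nlinarith
  have hlo : (fun y : ℝ => (y - x) ^ (k + 1)) =o[𝓝 x] fun y => (y - x) ^ k := by
    have : Tendsto (fun y : ℝ => y - x) (𝓝 x) (𝓝 0) := by
      simpa using (continuous_sub_right x).tendsto x
    simpa [pow_succ] using
      (Asymptotics.isBigO_refl (fun y : ℝ => (y - x) ^ k) (𝓝 x)).mul_isLittleO
        ((Asymptotics.isLittleO_one_iff ℝ).2 this)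
  have ht1 : Tendsto (logTaylor k p x (Real.log c) c⁻¹) (𝓝 x) (𝓝 (Real.log c)) := by
    have := (contDiff_logTaylor k p x (Real.log c) c⁻¹ (m := 0)).continuous.tendsto x
    rwa [logTaylor_self] at this
  have ht2 : Tendsto (fun y => Real.log (p.eval y)) (𝓝 x) (𝓝 (Real.log c)) :=
    (p.continuous.tendsto x).log hx.ne'
  have hexp := (Real.hasStrictDerivAt_exp (Real.log c)).hasStrictFDerivAt.isBigO_sub.comp_tendsto
    (ht1.prodMk_nhds ht2)
  have := (hexp.trans hlog).trans_isLittleO hlo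
  refine this.congr' ?_ EventuallyEq.rfl
  filter_upwards [(p.continuous.tendsto x).eventually_const_lt hx] with y hy
  simp [Function.comp, Real.exp_log hy]

/-- The value at `x` of `exp (-S) * L (exp S * (1 + W (p - p(x))))`, as a function of `x`, `S`
and `W`. -/
noncomputable def logJet {Ω : Set ℝ} (k : ℕ) (L : (ℝ → ℝ) → C(Ω, ℝ)) (p : ℝ[X]) (x : Ω)
    (S W : ℝ) : ℝ :=
  expConj L (logTaylor k p x S W) x

/-- Growth at `0+` orders the monomials lexicographically, the power of `z⁻¹` first and the power of
`log z` second. -/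
theorem tendsto_log_pow_mul_inv_pow_div {a d a' d' : ℕ} (h : d < d' ∨ d = d' ∧ a < a') :
    Tendsto (fun z : ℝ => (Real.log z ^ a * z⁻¹ ^ d) / (Real.log z ^ a' * z⁻¹ ^ d')) (𝓝[>] 0)
      (𝓝 0) := by
  have hlog : Tendsto (fun z => -Real.log z) (𝓝[>] 0) atTop :=
    tendsto_neg_atBot_atTop.comp Real.tendsto_log_nhdsGT_zero
  rw [tendsto_zero_iff_norm_tendsto_zero]
  rcases h with h | ⟨rfl, h⟩
  · have h1 := (Real.tendsto_pow_mul_exp_neg_atTop_nhds_zero a).comp hlog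
    refine squeeze_zero' (Eventually.of_forall fun _ => norm_nonneg _) ?_ h1
    filter_upwards [hlog.eventually_ge_atTop 1, self_mem_nhdsWithin] with z hz hz0
    have hz0 : 0 < z := hz0
    have hz1 : z ≤ 1 := by
      by_contra hcon
      have := Real.log_pos (not_le.1 hcon)
      linarith
    obtain ⟨e, rfl⟩ := Nat.exists_eq_add_of_lt h
    have habs : |Real.log z| = -Real.log z := abs_of_nonpos (by linarith)
    simp only [Function.comp, neg_neg, Real.exp_log hz0, norm_div, norm_mul, norm_pow,
      Real.norm_eq_abs, abs_inv, abs_of_pos hz0, habs]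
    have hl : 1 ≤ (-Real.log z) ^ a' := one_le_pow₀ hz
    have hla : 0 ≤ (-Real.log z) ^ a := by positivity
    have e1 : z⁻¹ ^ d / z⁻¹ ^ (d + e + 1) = z ^ (e + 1) := by
      rw [add_assoc, pow_add, inv_pow, inv_pow]; field_simp
    rw [mul_div_mul_comm, e1]
    refine mul_le_mul (div_le_self hla hl) ?_ (by positivity) hla
    exact pow_le_of_le_one hz0.le hz1 (by omega)
  · have h1 := (tendsto_pow_div_pow_atTop_zero (𝕜 := ℝ) h).comp hlog
    refine h1.congr' ?_
    filter_upwards [hlog.eventually_ge_atTop 1, self_mem_nhdsWithin] with z hz hz0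
    have hz0 : 0 < z := hz0
    have habs : |Real.log z| = -Real.log z := abs_of_nonpos (by linarith)
    simp only [Function.comp, norm_div, norm_mul, norm_pow,
      Real.norm_eq_abs, abs_inv, abs_of_pos hz0, habs]
    rw [mul_div_mul_right _ _ (by positivity)]

/-- `P.divX` tends to `Q.eval 0` at infinity, so it is constant and `P` is affine. -/
theorem Polynomial.eval_one_eq_of_eval_eq_mul_eval_inv {P Q : ℝ[X]}
    (h : ∀ s : ℝ, s ≠ 0 → P.eval s = s * Q.eval s⁻¹) : P.eval 1 = P.eval 0 + Q.eval 0 := by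
  have hdiv : ∀ s : ℝ, P.eval s = P.divX.eval s * s + P.eval 0 := by
    intro s
    conv_lhs => rw [← Polynomial.divX_mul_X_add P]
    simp [Polynomial.coeff_zero_eq_eval_zero]
  have hlim : Tendsto (fun s => P.divX.eval s) atTop (𝓝 (Q.eval 0)) := by
    have h1 : Tendsto (fun s : ℝ => Q.eval s⁻¹ - P.eval 0 * s⁻¹) atTop
        (𝓝 (Q.eval 0 - P.eval 0 * 0)) :=
      ((Q.continuous.tendsto 0).comp tendsto_inv_atTop_zero).sub
        (tendsto_inv_atTop_zero.const_mul _)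
    rw [mul_zero, sub_zero] at h1
    refine h1.congr' ?_
    filter_upwards [eventually_gt_atTop 0] with s hs
    have h2 := hdiv s
    rw [h s hs.ne'] at h2
    refine mul_left_cancel₀ hs.ne' ?_
    rw [mul_sub, h2, mul_left_comm, mul_inv_cancel₀ hs.ne']
    ring
  obtain ⟨h1, h2⟩ := (Polynomial.tendsto_nhds_iff _).1 hlim
  rw [hdiv 1, Polynomial.eq_C_of_degree_le_zero h2] 
  rw [Polynomial.eq_C_of_degree_le_zero h2, Polynomial.leadingCoeff_C] at h1
  rw [Polynomial.eval_C, h1]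
  ring

theorem contDiff_polynomial_eval (p : ℝ[X]) {m : WithTop ℕ∞} :
    ContDiff ℝ m fun y => p.eval y := by
  simpa using p.contDiff_aeval (𝕜 := ℝ) m

/-! ### Linearity of the jet functional -/

namespace IsLeibnizOp

variable {k n : ℕ} {Ω : Set ℝ} {L : (ℝ → ℝ) → C(Ω, ℝ)}

/-- Binomial expansion of `(p - p(x)) ^ i` moves the dependence on `x` into the coefficients of the
fixed functions `p ^ j`. -/
theorem isParamPoly_logJet (hΩ : IsOpen Ω) (hL : IsLeibnizOp k n L) (p : ℝ[X]) :
    IsParamPoly (logJet (Ω := Ω) k L p) := by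
  have hcoeff : ∀ i, IsParamPoly fun (_ : Ω) S W => logCoeff S W i := by
    intro i
    cases i with
    | zero => exact IsParamPoly.fst
    | succ i => exact (IsParamPoly.of_continuous continuous_const).mul (IsParamPoly.snd.pow _)
  have h := hL.isParamPoly_expConj_sum hΩ
    ((Finset.range (k + 1)).sigma fun i => Finset.range (i + 1))
    (G := fun q y => p.eval y ^ q.2)
    (σ := fun q x S W => logCoeff S W q.1 * ((-p.eval (x : ℝ)) ^ (q.1 - q.2) * q.1.choose q.2))
    (fun q _ => ((contDiff_polynomial_eval p).pow _).contDiffOn)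
    (fun q _ => (hcoeff q.1).mul (IsParamPoly.of_continuous (by fun_prop)))
    (g := 0) contDiffOn_const
  refine (congrArg IsParamPoly ?_).mpr h
  funext x S W
  rw [logJet]
  congr 1
  ext y
  rw [Pi.add_apply, Pi.zero_apply, zero_add, Finset.sum_apply, Finset.sum_sigma, logTaylor]
  refine Finset.sum_congr rfl fun i _ => ?_
  rw [sub_eq_add_neg, add_pow, Finset.mul_sum]
  refine Finset.sum_congr rfl fun j _ => ?_
  simp only [Pi.smul_apply, smul_eq_mul]
  ring

theorem apply_eq_mul_logJet (hΩ : IsOpen Ω) (hL : IsLeibnizOp k n L) {F : ℝ → ℝ}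
    (hF : ContDiffOn ℝ k F Ω) {x : Ω} {p : ℝ[X]} (hp : 0 < p.eval (x : ℝ))
    (h : (fun y => F y - p.eval y) =o[𝓝 (x : ℝ)] fun y => (y - (x : ℝ)) ^ k) :
    L F x = p.eval (x : ℝ) *
      logJet k L p x (Real.log (p.eval (x : ℝ))) (p.eval (x : ℝ))⁻¹ := by
  have h1 := exp_logTaylor_sub_isLittleO k p hp
  rw [logJet, hL.eq_of_isLittleO hΩ hF
    (contDiff_logTaylor k p x (Real.log (p.eval (x : ℝ))) (p.eval (x : ℝ))⁻¹).exp.contDiffOn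
    ((h1.sub h).congr_left fun y => by ring), apply_exp_eq, logTaylor_self, Real.exp_log hp]

theorem logJet_sub_C (p : ℝ[X]) (a : ℝ) (x : Ω) (S W : ℝ) :
    logJet k L (p - Polynomial.C a) x S W = logJet k L p x S W := by
  have : logTaylor k (p - Polynomial.C a) x S W = logTaylor k p x S W := by
    ext y
    simp [logTaylor]
  rw [logJet, this, logJet]

theorem logJet_of_eval_eq (hL : IsLeibnizOp k n L) {p : ℝ[X]} {x : Ω} {S W : ℝ}
    (h : ∀ y, logTaylor k p x S W y = S) : logJet k L p x S W = 0 := by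
  rw [logJet, expConj, show logTaylor k p x S W = fun _ => S from funext h, hL.map_const]
  simp

theorem logJet_zero_right (hL : IsLeibnizOp k n L) (p : ℝ[X]) (x : Ω) (S : ℝ) :
    logJet k L p x S 0 = 0 :=
  hL.logJet_of_eval_eq fun y => by simp [logTaylor, Finset.sum_range_succ', logCoeff]

theorem logJet_C (hL : IsLeibnizOp k n L) (a : ℝ) (x : Ω) (S W : ℝ) :
    logJet k L (Polynomial.C a) x S W = 0 :=
  hL.logJet_of_eval_eq fun y => by simp [logTaylor, Finset.sum_range_succ', logCoeff]

/-- With `ζ = p - p(x)`, the value `L ζ` at `y` is `ζ` times the sum of the terms `P_m(y) (log ζ)^(m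
0) ζ^(-m 1)`. Dividing by the dominant monomial and letting `ζ → 0+` isolates its coefficient, while
the left side tends to `0`. -/
theorem coeff_logJet_eq_zero_of_max (hΩ : IsOpen Ω) (hL : IsLeibnizOp k n L) {p : ℝ[X]}
    {P : MvPolynomial (Fin 2) C(Ω, ℝ)}
    (hP : ∀ (x : Ω) S W, logJet k L p x S W = paramEval x S W P) {m : Fin 2 →₀ ℕ}
    (hm : 1 < m 1 ∨ 1 = m 1 ∧ 0 < m 0) {x : Ω} (hx : p.derivative.eval (x : ℝ) ≠ 0)
    (hmax : ∀ m' ∈ P.support, m' ≠ m → (m' 1 < m 1 ∨ m' 1 = m 1 ∧ m' 0 < m 0) ∨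
      ∀ᶠ y in 𝓝 x, P.coeff m' y = 0) : P.coeff m x = 0 := by
  by_cases hms : m ∈ P.support
  swap
  · rw [MvPolynomial.notMem_support_iff.1 hms]; rfl
  set ζ : Ω → ℝ := fun y => p.eval (y : ℝ) - p.eval (x : ℝ) with hζ
  set l : Filter Ω := 𝓝 x ⊓ 𝓟 {y | 0 < ζ y} with hl
  -- Since `p'(x) ≠ 0`, `x` is not a local maximum, so `ζ > 0` at points arbitrarily near `x`.
  have hne : l.NeBot := by
    rw [hl, ← frequently_mem_iff_neBot]
    have h1 : ∃ᶠ y in 𝓝 (x : ℝ), p.eval (x : ℝ) < p.eval y := by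
      intro hcon
      have hmx : IsLocalMax (fun y => p.eval y) (x : ℝ) := hcon.mono fun y hy => not_lt.1 hy
      exact hx (by simpa using hmx.deriv_eq_zero)
    rw [← hΩ.isOpenEmbedding_subtypeVal.map_nhds_eq, Filter.frequently_map] at h1
    exact h1.mono fun y hy => sub_pos.2 hy
  have hlx : l ≤ 𝓝 x := inf_le_left
  have hζ0 : Tendsto ζ l (𝓝[>] 0) := by
    refine tendsto_nhdsWithin_iff.2 ⟨?_, ?_⟩
    · have : Continuous ζ := by fun_prop
      have h2 := this.tendsto x
      simp only [hζ, sub_self] at h2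
      exact h2.mono_left hlx
    · exact mem_inf_of_right (mem_principal_self _)
  set w : ℕ → ℕ → Ω → ℝ := fun a d y => Real.log (ζ y) ^ a * (ζ y)⁻¹ ^ d with hw
  set q : ℝ[X] := p - Polynomial.C (p.eval (x : ℝ)) with hq
  have hqe : ∀ y : Ω, q.eval (y : ℝ) = ζ y := fun y => by simp [hq, hζ]
  have hid : ∀ᶠ y in l, ∑ m' ∈ P.support, P.coeff m' y * (w (m' 0) (m' 1) y / w (m 0) (m 1) y) =
      L (fun y => q.eval y) y * (w 0 1 y / w (m 0) (m 1) y) := by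
    filter_upwards [mem_inf_of_right (mem_principal_self _)] with y hy
    have hy : 0 < ζ y := hy
    have h1 := hL.apply_eq_mul_logJet hΩ (contDiff_polynomial_eval q).contDiffOn
      (x := y) (p := q) (by rw [hqe]; exact hy) (by simp)
    rw [hqe, logJet_sub_C, hP, paramEval_eq_sum] at h1
    rw [h1]
    simp only [mul_div_assoc', ← Finset.sum_div]
    congr 1
    simp only [hw, pow_zero, one_mul, pow_one]
    field_simp
  have hlim1 : Tendsto (fun y => L (fun y => q.eval y) y * (w 0 1 y / w (m 0) (m 1) y)) l
      (𝓝 0) := by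
    have h1 := ((L fun y => q.eval y).continuous.tendsto x).mono_left hlx
    have h2 := (tendsto_log_pow_mul_inv_pow_div (a := 0) (d := 1) hm).comp hζ0
    rw [← mul_zero (L (fun y => q.eval y) x)]
    exact h1.mul h2
  have hlim2 : Tendsto (fun y => ∑ m' ∈ P.support,
      P.coeff m' y * (w (m' 0) (m' 1) y / w (m 0) (m 1) y)) l
      (𝓝 (∑ m' ∈ P.support, if m' = m then P.coeff m x else 0)) := by
    refine tendsto_finsetSum _ fun m' hm' => ?_
    have hc := ((P.coeff m').continuous.tendsto x).mono_left hlx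
    split_ifs with h
    · subst h
      refine hc.congr' ?_
      have hlog : ∀ᶠ z in 𝓝[>] (0 : ℝ), Real.log z < 0 :=
        Real.tendsto_log_nhdsGT_zero.eventually_lt_atBot 0
      filter_upwards [hζ0.eventually hlog, mem_inf_of_right (mem_principal_self _)] with y hy hy0
      have hy0 : 0 < ζ y := hy0
      have : w (m' 0) (m' 1) y ≠ 0 :=
        mul_ne_zero (pow_ne_zero _ hy.ne) (pow_ne_zero _ (inv_ne_zero hy0.ne'))
      rw [div_self this, mul_one]
    · rcases hmax m' hm' h with h1 | h1
      · have h2 := (tendsto_log_pow_mul_inv_pow_div h1).comp hζ0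
        rw [← mul_zero (P.coeff m' x)]
        exact hc.mul h2
      · refine tendsto_const_nhds.congr' ?_
        filter_upwards [hlx h1] with y hy
        rw [hy, zero_mul]
  rw [Finset.sum_ite_eq_of_mem' _ _ _ hms] at hlim2
  exact tendsto_nhds_unique (hlim2.congr' hid) hlim1

theorem logJet_eq_mul (hΩ : IsOpen Ω) (hL : IsLeibnizOp k n L) (p : ℝ[X]) (x : Ω) (S W : ℝ) :
    logJet k L p x S W = logJet k L p x 0 1 * W := by
  by_cases hp : p.derivative = 0
  · rw [Polynomial.eq_C_of_derivative_eq_zero hp, hL.logJet_C, hL.logJet_C, zero_mul]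
  obtain ⟨P, hP⟩ := hL.isParamPoly_logJet hΩ p
  have hO : ∀ x : Ω, p.derivative.eval (x : ℝ) ≠ 0 → ∀ m : Fin 2 →₀ ℕ,
      (1 < m 1 ∨ 1 = m 1 ∧ 0 < m 0) → P.coeff m x = 0 := by
    by_contra! hcon
    obtain ⟨x₁, hx₁, m₁, hm₁, hne₁⟩ := hcon
    classical
    let B : Finset (Fin 2 →₀ ℕ) := P.support.filter fun m =>
      (1 < m 1 ∨ 1 = m 1 ∧ 0 < m 0) ∧
        ∃ x : Ω, p.derivative.eval (x : ℝ) ≠ 0 ∧ P.coeff m x ≠ 0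
    have hB : B.Nonempty := ⟨m₁, Finset.mem_filter.2
      ⟨MvPolynomial.mem_support_iff.2 fun h => hne₁ (by rw [h]; rfl), hm₁, x₁, hx₁, hne₁⟩⟩
    -- The lexicographically largest offending exponent dominates. Exponents outside `B` are lower
    -- or have coefficients vanishing near `x₂`, because `p' ≠ 0` is an open condition.
    obtain ⟨m, hmB, hmax⟩ := B.exists_max_image (fun m => toLex (m 1, m 0)) hB
    obtain ⟨hms, hm, x₂, hx₂, hne₂⟩ := Finset.mem_filter.1 hmB
    refine hne₂ (hL.coeff_logJet_eq_zero_of_max hΩ hP hm hx₂ fun m' hm' hmm' => ?_)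
    by_cases hm'B : m' ∈ B
    · left
      have h1 := hmax m' hm'B
      rw [Prod.Lex.toLex_le_toLex] at h1
      rcases h1 with h1 | ⟨h1, h2⟩
      · exact Or.inl h1
      · refine Or.inr ⟨h1, lt_of_le_of_ne h2 fun h3 => hmm' ?_⟩
        ext i
        fin_cases i
        · exact h3
        · exact h1
    · by_cases hb : 1 < m' 1 ∨ 1 = m' 1 ∧ 0 < m' 0
      · right
        have hcont : Continuous fun y : Ω => p.derivative.eval (y : ℝ) := by fun_prop
        filter_upwards [hcont.continuousAt.eventually_ne hx₂] with y hy
        by_contra hy0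
        exact hm'B (Finset.mem_filter.2 ⟨hm', hb, y, hy, hy0⟩)
      · left
        omega
  have hall : ∀ m : Fin 2 →₀ ℕ, (1 < m 1 ∨ 1 = m 1 ∧ 0 < m 0) → ∀ x : Ω, P.coeff m x = 0 := by
    intro m hm x
    refine eq_of_frequently_eq hΩ (P.coeff m).continuous (ψ := fun _ => 0) continuous_const ?_
    -- The roots of `p'` are finite in number, so continuity removes the restriction `p'(x) ≠ 0`.
    have hd : Dense {y : ℝ | p.derivative.eval y ≠ 0} := by
      have : {y : ℝ | p.derivative.eval y ≠ 0} = {y | p.derivative.IsRoot y}ᶜ := rfl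
      rw [this]
      exact (Polynomial.finite_setOfPred_isRoot hp).countable.dense_compl ℝ
    exact (mem_closure_iff_frequently.1 (hd (x : ℝ))).mono fun y hy hyΩ => hO ⟨y, hyΩ⟩ hy m hm
  have hW : ∀ S W, logJet k L p x S W = logJet k L p x S 0 + P.coeff (Finsupp.single 1 1) x * W := by
    intro S W
    have hsub : ∀ S W, paramEval x S W P =
        ∑ m ∈ insert (Finsupp.single 1 1) P.support, P.coeff m x * (S ^ m 0 * W ^ m 1) := by
      intro S W
      rw [paramEval_eq_sum]
      refine Finset.sum_subset (Finset.subset_insert _ _) fun m _ hm => ?_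
      rw [MvPolynomial.notMem_support_iff.1 hm]
      simp
    rw [hP, hP, hsub, hsub, ← sub_eq_iff_eq_add', ← Finset.sum_sub_distrib,
      Finset.sum_eq_single_of_mem (Finsupp.single 1 1) (Finset.mem_insert_self _ _)]
    · simp
    · intro m _ hne
      by_cases hb : 1 < m 1 ∨ 1 = m 1 ∧ 0 < m 0
      · rw [hall m hb x]; simp
      · have h1 : m 1 = 0 := by
          by_contra h
          refine hne ?_
          ext i
          fin_cases i
          · simp; omega
          · simp; omega
        simp [h1]
  rw [hW S W, hW 0 1, hL.logJet_zero_right, hL.logJet_zero_right]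
  ring

/-- Scaling `p` has the same effect as scaling `W`, and the dependence on `W` is linear. -/
theorem logJet_smul (hΩ : IsOpen Ω) (hL : IsLeibnizOp k n L) (a : ℝ) (p : ℝ[X]) (x : Ω) :
    logJet k L (a • p) x 0 1 = a * logJet k L p x 0 1 := by
  rw [mul_comm, ← hL.logJet_eq_mul hΩ p x 0 a, logJet, logJet]
  congr 1
  ext y
  refine Finset.sum_congr rfl fun i _ => ?_
  cases i with
  | zero => simp [logCoeff]
  | succ i =>
    rw [Polynomial.eval_smul, Polynomial.eval_smul, logCoeff, logCoeff, ← smul_sub, smul_eq_mul,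
      mul_pow]
    ring

theorem exists_polynomial_logJet_add_smul (hΩ : IsOpen Ω) (hL : IsLeibnizOp k n L) (p q : ℝ[X])
    (x : Ω) : ∃ P : ℝ[X], ∀ s, logJet k L (p + s • q) x 0 1 = P.eval s := by
  have h := hL.isParamPoly_expConj_sum hΩ
    ((Finset.range (k + 1)).sigma fun i => Finset.range (i + 1))
    (G := fun r y => logCoeff 0 1 r.1 * ((q.eval y - q.eval (x : ℝ)) ^ r.2 *
      (p.eval y - p.eval (x : ℝ)) ^ (r.1 - r.2) * r.1.choose r.2))
    (σ := fun r _ _ W => W ^ r.2)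
    (fun r _ => (contDiff_const.mul (((((contDiff_polynomial_eval q).sub contDiff_const).pow _).mul
      (((contDiff_polynomial_eval p).sub contDiff_const).pow _)).mul contDiff_const)).contDiffOn)
    (fun r _ => IsParamPoly.snd.pow _)
    (g := 0) contDiffOn_const
  obtain ⟨P, hP⟩ := h.exists_polynomial x 0
  refine ⟨P, fun s => ?_⟩
  rw [← hP, logJet]
  congr 1
  ext y
  rw [Pi.add_apply, Pi.zero_apply, zero_add, Finset.sum_apply, Finset.sum_sigma, logTaylor]
  refine Finset.sum_congr rfl fun i _ => ?_
  have : (p + s • q).eval y - (p + s • q).eval (x : ℝ) =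
      s * (q.eval y - q.eval (x : ℝ)) + (p.eval y - p.eval (x : ℝ)) := by
    simp; ring
  rw [this, add_pow, Finset.mul_sum]
  refine Finset.sum_congr rfl fun j _ => ?_
  simp only [Pi.smul_apply, smul_eq_mul, mul_pow]
  ring

/-- By homogeneity, `P(s) = s Q(1/s)` for the two polynomials along `p + s • q` and `q + s • p`;
hence both are affine. -/
theorem logJet_add (hΩ : IsOpen Ω) (hL : IsLeibnizOp k n L) (p q : ℝ[X]) (x : Ω) :
    logJet k L (p + q) x 0 1 = logJet k L p x 0 1 + logJet k L q x 0 1 := by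
  obtain ⟨P, hP⟩ := hL.exists_polynomial_logJet_add_smul hΩ p q x
  obtain ⟨Q, hQ⟩ := hL.exists_polynomial_logJet_add_smul hΩ q p x
  have h := Polynomial.eval_one_eq_of_eval_eq_mul_eval_inv (P := P) (Q := Q) fun s hs => by
    rw [← hP, ← hQ, ← hL.logJet_smul hΩ, smul_add, smul_smul, mul_inv_cancel₀ hs, one_smul,
      add_comm]
  simpa [← hP, ← hQ] using h

/-- The map `p ↦ L (1 + p - p(x)) (x)`, as a linear functional on polynomials. -/
noncomputable def logJetLinear (hΩ : IsOpen Ω) (hL : IsLeibnizOp k n L) (x : Ω) : ℝ[X] →ₗ[ℝ] ℝ where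
  toFun p := logJet k L p x 0 1
  map_add' p q := hL.logJet_add hΩ p q x
  map_smul' a p := hL.logJet_smul hΩ a p x

theorem exists_coeff_of_pos (hΩ : IsOpen Ω) (hL : IsLeibnizOp k n L) :
    ∃ c : ℕ → C(Ω, ℝ), c 0 = 0 ∧ ∀ F, ContDiffOn ℝ k F Ω → ∀ x : Ω, 0 < F x →
      L F x = ∑ i ∈ Finset.range (k + 1), c i x * iteratedDeriv i F x := by
  let Λ : Ω → ℝ[X] →ₗ[ℝ] ℝ := fun x => hL.logJetLinear hΩ x
  have hΛ : ∀ p, Continuous fun x => Λ x p := fun p => (hL.isParamPoly_logJet hΩ p).continuous 0 1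
  -- The argument `(X - x) ^ i` moves with `x`; it is expanded in the fixed monomials `X ^ j`, on
  -- which continuity is known.
  have hpow : ∀ i, Continuous fun x : Ω => Λ x ((Polynomial.X - Polynomial.C (x : ℝ)) ^ i) := by
    intro i
    have h1 : ∀ x : Ω, (Polynomial.X - Polynomial.C (x : ℝ)) ^ i =
        ∑ j ∈ Finset.range (i + 1), ((-(x : ℝ)) ^ (i - j) * i.choose j) • Polynomial.X ^ j := by
      intro x
      rw [sub_eq_add_neg, add_pow]
      refine Finset.sum_congr rfl fun j _ => ?_
      rw [Polynomial.smul_eq_C_mul]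
      simp
      ring
    simp only [h1, map_sum, map_smul, smul_eq_mul]
    exact continuous_finsetSum _ fun j _ => (by fun_prop : Continuous fun x : Ω =>
      (-(x : ℝ)) ^ (i - j) * (i.choose j : ℝ)).mul (hΛ _)
  refine ⟨fun i => ⟨fun x => Λ x ((Polynomial.X - Polynomial.C (x : ℝ)) ^ i) / i.factorial,
    (hpow i).div_const _⟩, ?_, fun F hF x hx => ?_⟩
  · ext x
    have : Λ x (Polynomial.C 1) = 0 := hL.logJet_C 1 x 0 1
    simpa using this
  set p : ℝ[X] := ∑ i ∈ Finset.range (k + 1), (iteratedDeriv i F x / i.factorial) •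
    (Polynomial.X - Polynomial.C (x : ℝ)) ^ i with hp
  have hpe : ∀ y, p.eval y = ∑ i ∈ Finset.range (k + 1),
      iteratedDeriv i F x / i.factorial * (y - x) ^ i := by
    intro y
    simp [hp, Polynomial.eval_finsetSum]
  have hpx : p.eval (x : ℝ) = F x := by
    rw [hpe, Finset.sum_range_succ']
    simp
  have h1 := hL.apply_eq_mul_logJet hΩ hF (x := x) (p := p) (by rwa [hpx])
    (by simpa only [hpe] using hF.taylor_isLittleO hΩ x.2)
  rw [h1, hL.logJet_eq_mul hΩ, mul_comm _ (_⁻¹), mul_inv_cancel_left₀ (by rw [hpx]; exact hx.ne')]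
  change Λ x p = _
  rw [hp, map_sum]
  refine Finset.sum_congr rfl fun i _ => ?_
  rw [map_smul, smul_eq_mul, ContinuousMap.coe_mk]
  ring

end IsLeibnizOp

/-! ### The coefficients of the operator -/

theorem iteratedDeriv_sub_pow_self (i m : ℕ) (a : ℝ) :
    iteratedDeriv i (fun y => (y - a) ^ m) a = if i = m then (m.factorial : ℝ) else 0 := by
  rw [iteratedDeriv_comp_sub_const i (fun y => y ^ m) a]
  simp only [sub_self]
  rw [iteratedDeriv_fun_pow_zero]
  push_cast
  rfl

theorem ContDiffOn.continuous_iteratedDeriv_subtype {Ω : Set ℝ} (hΩ : IsOpen Ω) {k i : ℕ}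
    (hi : i ≤ k) {F : ℝ → ℝ} (hF : ContDiffOn ℝ k F Ω) :
    Continuous fun x : Ω => iteratedDeriv i F x := by
  have h := hF.continuousOn_iteratedDerivWithin (m := i) (by exact_mod_cast hi) hΩ.uniqueDiffOn
  exact continuousOn_iff_continuous_domRestrict.1
    (h.congr fun x hx => (iteratedDerivWithin_of_isOpen hΩ hx).symm)

namespace IsLeibnizOp

variable {k n : ℕ} {Ω : Set ℝ} {L : (ℝ → ℝ) → C(Ω, ℝ)}

/-- At a simple zero of a polynomial, the formulas for positive and for negative values are both
limits of the same continuous function, so the two sets of coefficients agree. -/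
theorem exists_coeff_of_ne_zero (hΩ : IsOpen Ω) (hL : IsLeibnizOp k n L) :
    ∃ c : ℕ → C(Ω, ℝ), c 0 = 0 ∧ ∀ F, ContDiffOn ℝ k F Ω → ∀ x : Ω, F x ≠ 0 →
      L F x = ∑ i ∈ Finset.range (k + 1), c i x * iteratedDeriv i F x := by
  obtain ⟨c, hc0, hc⟩ := hL.exists_coeff_of_pos hΩ
  obtain ⟨c', hc0', hc'⟩ := hL.neg_comp_neg.exists_coeff_of_pos hΩ
  have hneg : ∀ F, ContDiffOn ℝ k F Ω → ∀ x : Ω, F x < 0 →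
      L F x = ∑ i ∈ Finset.range (k + 1), c' i x * iteratedDeriv i F x := by
    intro F hF x hx
    have h := hc' (-F) hF.neg x (by simpa using hx)
    simp only [neg_neg, ContinuousMap.coe_neg, Pi.neg_apply, iteratedDeriv_neg, mul_neg,
      Finset.sum_neg_distrib, neg_inj] at h
    exact h
  have hsum : ∀ p : ℝ[X], ∀ x : Ω, p.eval (x : ℝ) = 0 → p.derivative.eval (x : ℝ) ≠ 0 →
      ∑ i ∈ Finset.range (k + 1), c i x * iteratedDeriv i (fun y => p.eval y) x =
      ∑ i ∈ Finset.range (k + 1), c' i x * iteratedDeriv i (fun y => p.eval y) x := by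
    intro p x h0 h1
    have hp : ContDiffOn ℝ k (fun y => p.eval y) Ω := (contDiff_polynomial_eval p).contDiffOn
    have hcont : ∀ c : ℕ → C(Ω, ℝ), Continuous fun x : Ω =>
        ∑ i ∈ Finset.range (k + 1), c i x * iteratedDeriv i (fun y => p.eval y) x := fun c =>
      continuous_finsetSum _ fun i hi => (c i).continuous.mul
        (hp.continuous_iteratedDeriv_subtype hΩ (Nat.lt_succ_iff.1 (Finset.mem_range.1 hi)))
    have hpos : ∃ᶠ y in 𝓝 (x : ℝ), 0 < p.eval y := by
      intro hcon
      have hmx : IsLocalMax (fun y => p.eval y) (x : ℝ) :=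
        hcon.mono fun y hy => by simpa [h0] using hy
      exact h1 (by simpa using hmx.deriv_eq_zero)
    have hnegf : ∃ᶠ y in 𝓝 (x : ℝ), p.eval y < 0 := by
      intro hcon
      have hmx : IsLocalMin (fun y => p.eval y) (x : ℝ) :=
        hcon.mono fun y hy => by simpa [h0] using hy
      exact h1 (by simpa using hmx.deriv_eq_zero)
    have e1 := eq_of_frequently_eq hΩ (L fun y => p.eval y).continuous (hcont c)
      (hpos.mono fun y hy hyΩ => hc _ hp ⟨y, hyΩ⟩ hy)
    have e2 := eq_of_frequently_eq hΩ (L fun y => p.eval y).continuous (hcont c')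
      (hnegf.mono fun y hy hyΩ => hneg _ hp ⟨y, hyΩ⟩ hy)
    exact e1.symm.trans e2
  have hpe : ∀ (b : ℝ) (m i : ℕ) (x : ℝ), iteratedDeriv i (fun y =>
      (Polynomial.X - Polynomial.C x + Polynomial.C b * (Polynomial.X - Polynomial.C x) ^ m).eval y)
        x = (if i = 1 then 1 else 0) + b * if i = m then (m.factorial : ℝ) else 0 := by
    intro b m i x
    have h1 := iteratedDeriv_sub_pow_self i 1 x
    have h2 := iteratedDeriv_sub_pow_self i m x
    simp only [pow_one, Nat.factorial_one, Nat.cast_one] at h1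
    rw [← h1, ← h2, ← iteratedDeriv_const_mul_field, ← iteratedDeriv_fun_add]
    · simp
    · exact (contDiff_id.sub contDiff_const).contDiffAt
    · exact (contDiff_const.mul ((contDiff_id.sub contDiff_const).pow m)).contDiffAt
  have hcc : ∀ m ≤ k, c m = c' m := by
    intro m hm
    ext x
    rcases Nat.lt_or_ge m 1 with h | h
    · obtain rfl : m = 0 := by omega
      rw [hc0, hc0']
    have h1k : 1 ∈ Finset.range (k + 1) := Finset.mem_range.2 (by omega)
    have hmk : m ∈ Finset.range (k + 1) := Finset.mem_range.2 (by omega)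
    -- The test polynomial is `(X - x) + b (X - x) ^ m`; the condition on `b` keeps its derivative
    -- at `x` equal to `1`.
    have key : ∀ b : ℝ, 2 ≤ m ∨ b = 0 → c 1 x + c m x * (b * m.factorial) =
        c' 1 x + c' m x * (b * m.factorial) := by
      intro b hb
      have h2 := hsum (Polynomial.X - Polynomial.C (x : ℝ) +
        Polynomial.C b * (Polynomial.X - Polynomial.C (x : ℝ)) ^ m) x
        (by simp; right; omega) (by
          rcases hb with hb | rfl
          · have : m - 1 ≠ 0 := by omega
            simp [Polynomial.derivative_pow, this]
          · simp)
      simpa only [hpe, mul_add, Finset.sum_add_distrib, mul_ite, mul_one, mul_zero,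
        Finset.sum_ite_eq_of_mem' _ _ _ h1k, Finset.sum_ite_eq_of_mem' _ _ _ hmk] using h2
    have k0 := key 0 (Or.inr rfl)
    simp only [zero_mul, mul_zero, add_zero] at k0
    rcases Nat.lt_or_ge m 2 with h2 | h2
    · obtain rfl : m = 1 := by omega
      exact k0
    · have k1 := key 1 (Or.inl h2)
      rw [k0, add_right_inj] at k1
      exact mul_right_cancel₀ (by positivity) k1
  refine ⟨c, hc0, fun F hF x hx => ?_⟩
  rcases lt_or_gt_of_ne hx with h | h
  · rw [hneg F hF x h]
    exact Finset.sum_congr rfl fun i hi => by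
      rw [hcc i (Nat.lt_succ_iff.1 (Finset.mem_range.1 hi))]
  · exact hc F hF x h

/-- Take `A = (y - x) ^ (m - n)` and `B = y - x`: both vanish at `x`, so only the term `a = 0`
remains. -/
theorem apply_sub_pow (hL : IsLeibnizOp k n L) {m : ℕ} (hm : n < m) (x : Ω) :
    L (fun y => (y - (x : ℝ)) ^ m) x = 0 := by
  obtain ⟨a, rfl⟩ := Nat.exists_eq_add_of_lt hm
  have hs : ∀ e : ℕ, ContDiffOn ℝ k (fun y => (y - (x : ℝ)) ^ e) Ω := fun e =>
    ((contDiff_id.sub contDiff_const).pow e).contDiffOn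
  have h := hL.leibniz (fun y => (y - (x : ℝ)) ^ (a + 1)) (fun y => (y - (x : ℝ)) ^ 1) (hs _) (hs _) x
  rw [Finset.sum_range_succ', Finset.sum_eq_zero (fun i _ => by simp)] at h
  have hf : (fun y => (y - (x : ℝ)) ^ (a + 1)) * (fun y => (y - (x : ℝ)) ^ 1) ^ (n - 0) =
      fun y => (y - (x : ℝ)) ^ (n + a + 1) := by
    ext y
    simp only [Pi.mul_apply, Pi.pow_apply, pow_one, Nat.sub_zero]
    ring
  rw [hf] at h
  simpa using h

theorem exists_coeff (hΩ : IsOpen Ω) (hL : IsLeibnizOp k n L) :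
    ∃ c : ℕ → C(Ω, ℝ), c 0 = 0 ∧ (∀ i, k < i ∨ n < i → c i = 0) ∧
      ∀ F, ContDiffOn ℝ k F Ω → ∀ x : Ω,
        L F x = ∑ i ∈ Finset.range (k + 1), c i x * iteratedDeriv i F x := by
  obtain ⟨c, hc0, hc⟩ := hL.exists_coeff_of_ne_zero hΩ
  have hall : ∀ F, ContDiffOn ℝ k F Ω → ∀ x : Ω,
      L F x = ∑ i ∈ Finset.range (k + 1), c i x * iteratedDeriv i F x := by
    intro F hF x
    have hcont : Continuous fun x : Ω => ∑ i ∈ Finset.range (k + 1), c i x * iteratedDeriv i F x :=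
      continuous_finsetSum _ fun i hi => (c i).continuous.mul
        (hF.continuous_iteratedDeriv_subtype hΩ (Nat.lt_succ_iff.1 (Finset.mem_range.1 hi)))
    refine eq_of_frequently_eq hΩ (L F).continuous hcont ?_
    -- Either `F` vanishes near `x` and locality applies, or `x` is a limit of points where `F ≠ 0`
    -- (possibly `x` itself).
    by_cases hz : ∀ᶠ y in 𝓝 (x : ℝ), F y = 0
    · refine Eventually.frequently ?_
      filter_upwards [hz.eventually_nhds] with y hy hyΩ
      have hy : F =ᶠ[𝓝 y] fun _ => 0 := hy
      rw [hL.eq_of_eventuallyEq (x := ⟨y, hyΩ⟩) hF contDiffOn_const hy, hL.map_const]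
      symm
      refine Finset.sum_eq_zero fun i _ => ?_
      rw [hy.iteratedDeriv_eq i]
      simp
    · exact (Filter.not_eventually.1 hz).mono fun y hy hyΩ => hc F hF ⟨y, hyΩ⟩ hy
  refine ⟨fun i => if k < i ∨ n < i then 0 else c i, ?_, fun i hi => if_pos hi, ?_⟩
  · simp [hc0]
  · intro F hF x
    rw [hall F hF x]
    refine Finset.sum_congr rfl fun i hi => ?_
    have hik : i ≤ k := Nat.lt_succ_iff.1 (Finset.mem_range.1 hi)
    dsimp only
    split_ifs with h
    · have h1 := hall (fun y => (y - (x : ℝ)) ^ i)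
        ((contDiff_id.sub contDiff_const).pow i).contDiffOn x
      rw [hL.apply_sub_pow (by omega)] at h1
      simp only [iteratedDeriv_sub_pow_self, mul_ite, mul_zero,
        Finset.sum_ite_eq_of_mem' _ _ _ hi] at h1
      have h2 : c i x = 0 := by
        rcases mul_eq_zero.1 h1.symm with h2 | h2
        · exact h2
        · exact absurd h2 (by positivity)
      simp [h2]
    · rfl

end IsLeibnizOp

/-! ### From the identity to the Leibniz rule -/

theorem mem_CkFun {k : ℕ} {Ω : Set ℝ} {F : ℝ → ℝ} (hF : ContDiffOn ℝ k F Ω) :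
    (fun x : Ω => F x) ∈ CkFun k Ω :=
  ContDiffOn.congr hF fun x hx => zeroExt_apply (fun x : Ω => F x) ⟨x, hx⟩

theorem zeroExt_eventuallyEq {Ω : Set ℝ} (hΩ : IsOpen Ω) {f : Ω → ℝ} {F : ℝ → ℝ}
    (h : ∀ y : Ω, f y = F y) (x : Ω) : zeroExt f =ᶠ[𝓝 (x : ℝ)] F := by
  filter_upwards [hΩ.mem_nhds x.2] with y hy
  exact (zeroExt_apply f ⟨y, hy⟩).trans (h ⟨y, hy⟩)

open Classical in
/-- An operator on `C^k(Ω)`, extended by zero to all functions on the real line. -/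
noncomputable def CkFun.extendOp {k : ℕ} {Ω : Set ℝ} (D : CkFun k Ω → C(Ω, ℝ)) (F : ℝ → ℝ) :
    C(Ω, ℝ) :=
  if hF : ContDiffOn ℝ k F Ω then D ⟨fun x => F x, mem_CkFun hF⟩ else 0

theorem CkFun.extendOp_eq {k : ℕ} {Ω : Set ℝ} (D : CkFun k Ω → C(Ω, ℝ)) {F : ℝ → ℝ}
    (hF : ContDiffOn ℝ k F Ω) {f : CkFun k Ω} (h : ∀ x : Ω, (f : Ω → ℝ) x = F x) :
    CkFun.extendOp D F = D f := by
  rw [CkFun.extendOp, dif_pos hF]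
  congr 1
  ext x
  exact (h x).symm

theorem CkFun.coe_prod_apply {k : ℕ} {Ω : Set ℝ} {ι : Type*} (s : Finset ι) (f : ι → CkFun k Ω)
    (x : Ω) : ((∏ m ∈ s, f m : CkFun k Ω) : Ω → ℝ) x = ∏ m ∈ s, (f m : Ω → ℝ) x := by
  simp

/-- The subset missing from (1) is the full index set, whose term is a multiple of `D 1 = 0`. -/
theorem sum_identity_eq_sum_powerset {k n : ℕ} {Ω : Set ℝ} {D : CkFun k Ω → C(Ω, ℝ)}
    (hD : D 1 = 0) (f : Fin (n + 1) → CkFun k Ω) (x : Ω) :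
    ∑ i ∈ Finset.range (n + 1), (-1 : ℝ) ^ i *
      ∑ I ∈ Finset.powersetCard i (Finset.univ : Finset (Fin (n + 1))),
        (∏ m ∈ I, (f m : Ω → ℝ) x) * D (∏ m ∈ Iᶜ, f m) x =
    ∑ I ∈ (Finset.univ : Finset (Fin (n + 1))).powerset,
      (-1 : ℝ) ^ I.card * ((∏ m ∈ I, (f m : Ω → ℝ) x) * D (∏ m ∈ Iᶜ, f m) x) := by
  have hc : (Finset.univ : Finset (Fin (n + 1))).card = n + 1 := by simp
  rw [Finset.sum_powerset, hc, Finset.sum_range_succ _ (n + 1)]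
  have hlast : Finset.powersetCard (n + 1) (Finset.univ : Finset (Fin (n + 1))) =
      {Finset.univ} := by
    have := Finset.powersetCard_self (Finset.univ : Finset (Fin (n + 1)))
    rwa [hc] at this
  rw [hlast, Finset.sum_singleton, Finset.compl_univ, Finset.prod_empty, hD]
  simp only [ContinuousMap.coe_zero, Pi.zero_apply, mul_zero, add_zero]
  refine Finset.sum_congr rfl fun i _ => ?_
  rw [Finset.mul_sum]
  refine Finset.sum_congr rfl fun I hI => ?_
  rw [(Finset.mem_powersetCard.1 hI).2]

theorem SatisfiesIdentity.isLeibnizOp {k n j : ℕ} {Ω : Set ℝ} {D : CkFun k Ω → C(Ω, ℝ)}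
    (hD : SatisfiesIdentity n D) (hA : AnnihilatesPolynomials j D) :
    IsLeibnizOp k n (CkFun.extendOp D) where
  map_const c := by
    rw [CkFun.extendOp, dif_pos contDiffOn_const]
    exact hA (Polynomial.C c) (by simp) _ (by simp)
  leibniz A B hA' hB x := by
    have h1 : D 1 = 0 := hA (Polynomial.C 1) (by simp) 1 (by simp)
    set a : CkFun k Ω := ⟨fun x => A x, mem_CkFun hA'⟩ with ha
    set b : CkFun k Ω := ⟨fun x => B x, mem_CkFun hB⟩ with hb
    have eA : ∀ m : ℕ, CkFun.extendOp D (A * B ^ m) = D (a * b ^ m) := fun m =>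
      CkFun.extendOp_eq D (hA'.mul (hB.pow m)) fun x => by simp [ha, hb]
    have eB : ∀ m : ℕ, CkFun.extendOp D (B ^ m) = D (b ^ m) := fun m =>
      CkFun.extendOp_eq D (hB.pow m) fun x => by simp [hb]
    have h := hD (fun i => if i = 0 then a else b) x
    rw [sum_identity_eq_sum_powerset h1] at h
    set s : Finset (Fin (n + 1)) := Finset.univ.erase 0 with hs
    have hsc : s.card = n := by simp [hs]
    have hins : (Finset.univ : Finset (Fin (n + 1))) = insert 0 s :=
      (Finset.insert_erase (Finset.mem_univ _)).symm
    have h0s : (0 : Fin (n + 1)) ∉ s := Finset.notMem_erase _ _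
    -- Subsets are split by whether they contain `0`, the index of `A`; among the others only the
    -- cardinality matters.
    rw [hins, Finset.sum_powerset_insert h0s, ← Finset.sum_add_distrib] at h
    have hcard := Finset.sum_powerset_apply_card (fun i => (-B x) ^ i *
      (D (a * b ^ (n - i)) x - A x * D (b ^ (n - i)) x)) (x := s)
    rw [hsc] at hcard
    simp only [eA, eB, ← nsmul_eq_mul]
    rw [← hcard, ← h]
    refine Finset.sum_congr rfl fun t ht => ?_
    have hts : t ⊆ s := Finset.mem_powerset.1 ht
    have h0t : (0 : Fin (n + 1)) ∉ t := fun h => h0s (hts h)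
    have hcompl : tᶜ = insert 0 (s \ t) := by
      ext i
      by_cases hi : i = 0 <;> simp [hs, hi, h0t]
    have hcompl2 : (insert 0 t)ᶜ = s \ t := by
      ext i
      by_cases hi : i = 0 <;> simp [hs, hi]
    have hst : (s \ t).card = n - t.card := by rw [Finset.card_sdiff_of_subset hts, hsc]
    have p1 : ∏ m ∈ s \ t, (if m = 0 then a else b) = b ^ (n - t.card) := by
      rw [← hst, ← Finset.prod_const]
      refine Finset.prod_congr rfl fun i hi => if_neg ?_
      rintro rfl
      exact h0s (Finset.mem_sdiff.1 hi).1
    have p2 : ∏ m ∈ t, (((if m = 0 then a else b : CkFun k Ω)) : Ω → ℝ) x = B x ^ t.card := by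
      rw [← Finset.prod_const]
      refine Finset.prod_congr rfl fun i hi => ?_
      rw [if_neg]
      rintro rfl
      exact h0t hi
    rw [hcompl, hcompl2, Finset.prod_insert (by simp [h0s]), Finset.prod_insert h0t, p1, p2,
      if_pos rfl, Finset.card_insert_of_notMem h0t]
    have : (a : Ω → ℝ) x = A x := rfl
    rw [this, neg_pow]
    ring

/-! ### The converse -/

/-- Each factor is `O(y - x)`, being differentiable since `i > 0`; the product is then `o((y - x) ^
i)`. -/
theorem iteratedDeriv_prod_sub_eq_zero {ι : Type*} (s : Finset ι) {Ω : Set ℝ} (hΩ : IsOpen Ω)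
    {x : ℝ} (hx : x ∈ Ω) {i : ℕ} (hi : 0 < i) (his : i < s.card) {g : ι → ℝ → ℝ}
    (hg : ∀ m, ContDiffOn ℝ i (g m) Ω) :
    iteratedDeriv i (fun y => ∏ m ∈ s, (g m y - g m x)) x = 0 := by
  refine iteratedDeriv_eq_zero_of_isLittleO hΩ hx
    (contDiffOn_prod fun m _ => (hg m).sub contDiffOn_const) ?_ i le_rfl
  have hO : (fun y => ∏ m ∈ s, (g m y - g m x)) =O[𝓝 x] fun y => ∏ m ∈ s, (y - x) := by
    refine Asymptotics.IsBigO.finsetProd fun m _ => ?_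
    have hd : DifferentiableAt ℝ (g m) x :=
      ((hg m).contDiffAt (hΩ.mem_nhds hx)).differentiableAt (by exact_mod_cast hi.ne')
    exact hd.isBigO_sub
  simp only [Finset.prod_const] at hO
  refine hO.trans_isLittleO ?_
  have ht : Tendsto (fun y : ℝ => y - x) (𝓝 x) (𝓝 0) := by
    simpa using (continuous_sub_right x).tendsto x
  exact (Asymptotics.isLittleO_pow_pow his).comp_tendsto ht

theorem iteratedDeriv_polynomial_eval (p : ℝ[X]) (i : ℕ) :
    iteratedDeriv i (fun y => p.eval y) = fun y => (Polynomial.derivative^[i] p).eval y := by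
  induction i with
  | zero => simp
  | succ i ih =>
    rw [iteratedDeriv_succ, ih, Function.iterate_succ_apply']
    ext y
    simp

namespace IsGivenBy

variable {k n j : ℕ} {Ω : Set ℝ} {D : CkFun k Ω → C(Ω, ℝ)} {c : ℕ → C(Ω, ℝ)}

/-- The test function is `(y - x) ^ m` right of `x` and its negative left of `x`; it is `C^k` as `k
< m`. Continuity of its image forces `R x = -R x`. Only derivatives off `x` enter, so default values
play no role. -/
theorem coeff_eq_zero (hΩ : IsOpen Ω) (h : IsGivenBy j n c D) {m : ℕ} (hm : m ∈ Finset.Icc (j + 1) n)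
    (hkm : k < m) : c m = 0 := by
  ext x
  set P : ℝ → ℝ := fun y => (y - (x : ℝ)) ^ m with hP
  have hPs : ∀ e : ℕ, ContDiff ℝ e P := fun e => (contDiff_id.sub contDiff_const).pow m
  have hI : ContDiffOn ℝ k ((Ici (x : ℝ)).indicator P) Ω :=
    (hPs k).contDiffOn.indicator_Ici hΩ k fun i hi => by
      rw [iteratedDeriv_sub_pow_self, if_neg (by omega)]
  have hF : ContDiffOn ℝ k (fun y => (Ici (x : ℝ)).indicator P y + (Ici (x : ℝ)).indicator P y - P y)
    Ω := (hI.add hI).sub (hPs k).contDiffOn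
  set F := fun y => (Ici (x : ℝ)).indicator P y + (Ici (x : ℝ)).indicator P y - P y with hFdef
  set f : CkFun k Ω := ⟨fun x => F x, mem_CkFun hF⟩
  let R : Ω → ℝ := fun y => ∑ i ∈ Finset.Icc (j + 1) n, c i y * iteratedDeriv i P y
  have hR : Continuous R := continuous_finsetSum _ fun i _ => (c i).continuous.mul
    (((hPs i).continuous_iteratedDeriv' i).comp continuous_subtype_val)
  have e1 : D f x = R x := by
    refine eq_of_frequently_eq hΩ (D f).continuous hR ?_
    have : ∃ᶠ y in 𝓝 (x : ℝ), (x : ℝ) < y := frequently_gt_nhds x.1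
    refine this.mono fun y hy hyΩ => ?_
    rw [h]
    refine Finset.sum_congr rfl fun i _ => ?_
    rw [derivAt, ((zeroExt_eventuallyEq hΩ (F := F) (fun _ => rfl) ⟨y, hyΩ⟩).trans
      ?_).iteratedDeriv_eq i]
    filter_upwards [Ioi_mem_nhds hy] with z hz
    simp [hFdef, indicator, (mem_Ioi.1 hz).le]
  have e2 : D f x = -R x := by
    refine eq_of_frequently_eq hΩ (D f).continuous (ψ := fun y => -R y) hR.neg ?_
    have : ∃ᶠ y in 𝓝 (x : ℝ), y < (x : ℝ) := frequently_lt_nhds x.1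
    refine this.mono fun y hy hyΩ => ?_
    rw [h]
    simp only [R, ← Finset.sum_neg_distrib, ← mul_neg]
    refine Finset.sum_congr rfl fun i _ => ?_
    rw [derivAt, ← iteratedDeriv_fun_neg,
      ((zeroExt_eventuallyEq hΩ (F := F) (fun _ => rfl) ⟨y, hyΩ⟩).trans ?_).iteratedDeriv_eq i]
    filter_upwards [Iio_mem_nhds hy] with z hz
    simp [hFdef, indicator, not_le.2 (mem_Iio.1 hz)]
  have e3 : R x = c m x * m.factorial := by
    simp only [R, hP, iteratedDeriv_sub_pow_self, mul_ite, mul_zero,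
      Finset.sum_ite_eq_of_mem' _ _ _ hm]
  have e4 : c m x * (m.factorial : ℝ) = 0 := by linarith
  rcases mul_eq_zero.1 e4 with h1 | h1
  · exact h1
  · exact absurd h1 (by positivity)

theorem annihilatesPolynomials (hΩ : IsOpen Ω) (h : IsGivenBy j n c D) :
    AnnihilatesPolynomials j D := by
  intro p hp f hf
  ext x
  rw [h]
  refine Finset.sum_eq_zero fun i hi => ?_
  rw [derivAt, (zeroExt_eventuallyEq hΩ (F := fun y => p.eval y) hf x).iteratedDeriv_eq i, iteratedDeriv_polynomial_eval,
    Polynomial.iterate_derivative_eq_zero (by have := (Finset.mem_Icc.1 hi).1; omega)]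
  simp

/-- The sum is the expanded `i`-th derivative of `∏ (f_m - f_m(x))` at `x`. -/
theorem sum_powerset_derivAt_eq_zero (hΩ : IsOpen Ω) {i : ℕ} (hi : 0 < i) (hik : i ≤ k)
    (hin : i ≤ n) (f : Fin (n + 1) → CkFun k Ω) (x : Ω) :
    ∑ I ∈ (Finset.univ : Finset (Fin (n + 1))).powerset, (-1 : ℝ) ^ I.card *
      ((∏ m ∈ I, (f m : Ω → ℝ) x) *
        derivAt i ((∏ m ∈ Iᶜ, f m : CkFun k Ω) : Ω → ℝ) x) = 0 := by
  set g : Fin (n + 1) → ℝ → ℝ := fun m => zeroExt (f m : Ω → ℝ) with hg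
  have hgx : ∀ m, ∀ y : Ω, g m y = (f m : Ω → ℝ) y := fun m y => zeroExt_apply _ y
  have hgs : ∀ m, ContDiffOn ℝ i (g m) Ω := fun m =>
    ContDiffOn.of_le (f m).2 (by exact_mod_cast hik)
  have h0 := iteratedDeriv_prod_sub_eq_zero (Finset.univ : Finset (Fin (n + 1))) hΩ x.2 hi
    (by simp; omega) hgs
  have hexp : (fun y => ∏ m, (g m y - g m x)) = fun y =>
      ∑ I ∈ (Finset.univ : Finset (Fin (n + 1))).powerset,
        ((-1 : ℝ) ^ I.card * ∏ m ∈ I, g m x) * ∏ m ∈ Iᶜ, g m y := by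
    ext y
    simp only [sub_eq_neg_add]
    rw [Finset.prod_add]
    refine Finset.sum_congr rfl fun I _ => ?_
    rw [Finset.prod_neg, Finset.compl_eq_univ_sdiff]
  rw [hexp, iteratedDeriv_fun_sum] at h0
  · rw [← h0]
    refine Finset.sum_congr rfl fun I _ => ?_
    rw [iteratedDeriv_const_mul_field, derivAt, (zeroExt_eventuallyEq hΩ
      (F := fun y => ∏ m ∈ Iᶜ, g m y) (fun y => ?_) x).iteratedDeriv_eq i]
    · simp only [hgx, mul_assoc]
    · simp only [hgx, CkFun.coe_prod_apply]
  · intro I _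
    exact contDiffAt_const.mul (contDiffAt_prod fun m _ =>
      (hgs m).contDiffAt (hΩ.mem_nhds x.2))

theorem satisfiesIdentity (hΩ : IsOpen Ω) (h : IsGivenBy j n c D) : SatisfiesIdentity n D := by
  intro f x
  have h1 : D 1 = 0 := h.annihilatesPolynomials hΩ (Polynomial.C 1) (by simp) 1 (by simp)
  rw [sum_identity_eq_sum_powerset h1]
  simp only [h _ x, Finset.mul_sum]
  rw [Finset.sum_comm]
  refine Finset.sum_eq_zero fun i hi => ?_
  by_cases hik : k < i
  · simp [h.coeff_eq_zero hΩ hi hik]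
  have hi' := Finset.mem_Icc.1 hi
  rw [← mul_zero (c i x), ← sum_powerset_derivAt_eq_zero hΩ (i := i) (by omega) (by omega) hi'.2 f x,
    Finset.mul_sum]
  refine Finset.sum_congr rfl fun I _ => ?_
  ring

end IsGivenBy

/-! ### Assembly -/

theorem mainTheorem3 (k n j : ℕ) (Ω : Set ℝ) (hΩ : IsOpen Ω) (hne : Ω.Nonempty)
    (D : CkFun k Ω → C(Ω, ℝ)) :
    (SatisfiesIdentity n D ∧ AnnihilatesPolynomials j D →
      (∃ c : ℕ → C(Ω, ℝ), IsGivenBy j n c D ∧ ∀ i, k < i → i ≤ n → c i = 0) ∧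
      (k ≤ j → ∀ f : CkFun k Ω, D f = 0)) ∧
    (∀ c : ℕ → C(Ω, ℝ), IsGivenBy j n c D →
      SatisfiesIdentity n D ∧ AnnihilatesPolynomials j D) := by
  refine ⟨fun ⟨hD, hA⟩ => ?_, fun c hc => ⟨hc.satisfiesIdentity hΩ, hc.annihilatesPolynomials hΩ⟩⟩
  obtain ⟨c, -, hc0, hc⟩ := (hD.isLeibnizOp hA).exists_coeff hΩ
  -- The polynomial `(X - x) ^ i` is annihilated, and its image at `x` is `c i x * i!`.
  have hcj : ∀ i ≤ j, c i = 0 := by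
    intro i hij
    by_cases hik : k < i
    · exact hc0 i (Or.inl hik)
    ext x
    have hs : ContDiffOn ℝ k (fun y => (y - (x : ℝ)) ^ i) Ω :=
      ((contDiff_id.sub contDiff_const).pow i).contDiffOn
    have h1 := hc _ hs x
    have h2 : CkFun.extendOp D (fun y => (y - (x : ℝ)) ^ i) = 0 := by
      rw [CkFun.extendOp, dif_pos hs]
      exact hA ((Polynomial.X - Polynomial.C (x : ℝ)) ^ i)
        (by rw [Polynomial.natDegree_pow, Polynomial.natDegree_X_sub_C]; omega) _ (by simp)
    rw [h2] at h1
    simp only [iteratedDeriv_sub_pow_self, mul_ite, mul_zero, ContinuousMap.coe_zero,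
      Pi.zero_apply, Finset.sum_ite_eq_of_mem' _ _ _ (Finset.mem_range.2 (show i < k + 1 by omega))]
      at h1
    rcases mul_eq_zero.1 h1.symm with h3 | h3
    · exact h3
    · exact absurd h3 (by positivity)
  have hDf : ∀ (f : CkFun k Ω) (x : Ω), D f x =
      ∑ i ∈ Finset.range (k + 1), c i x * derivAt i (f : Ω → ℝ) x := by
    intro f x
    rw [← CkFun.extendOp_eq D f.2 fun x => (zeroExt_apply (f : Ω → ℝ) x).symm]
    exact hc _ f.2 x
  refine ⟨⟨c, fun f x => ?_, fun i hi _ => hc0 i (Or.inl hi)⟩, fun hkj f => ?_⟩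
  -- Both sums are compared with the sum over the union of the index sets; the extra coefficients
  -- vanish.
  · rw [hDf, Finset.sum_subset Finset.subset_union_left (s₂ := Finset.range (k + 1) ∪
      Finset.Icc (j + 1) n) fun i _ hi => ?_]
    · symm
      refine Finset.sum_subset Finset.subset_union_right fun i _ hi => ?_
      have : i ≤ j ∨ n < i := by
        rw [Finset.mem_Icc] at hi
        omega
      rcases this with h | h
      · simp [hcj i h]
      · simp [hc0 i (Or.inr h)]
    · rw [Finset.mem_range] at hi
      simp [hc0 i (Or.inl (by omega))]
  · ext x
    rw [hDf]
    refine Finset.sum_eq_zero fun i hi => ?_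
    rw [hcj i ((Nat.lt_succ_iff.1 (Finset.mem_range.1 hi)).trans hkj)]
    simp
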